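/- A crossed module $[\varphi\colon G_2\to G_1]$ consists of groups $G_1,G_2$, a homomorphism $\varphi$ and a right action $(\alpha,g)\mapsto\alpha^g$ of $G_1$ on $G_2$ by automorphisms such that $\varphi(\alpha^g)=g^{-1}\varphi(\alpha)g$ and $\alpha^{\varphi(\beta)}=\beta^{-1}\alpha\beta$; put $\pi_1=G_1/\varphi(G_2)$ and $\pi_2=\ker\varphi$. Crossed modules are identified with (strict) 2-groups, and $\mathrm{Ho}(\mathbf{2Gp})$ is the category obtained from the category of crossed modules and strict morphisms by formally inverting the morphisms that induce isomorphisms on $\pi_1$ and $\pi_2$. A group $\Gamma$ is regarded as the crossed module $[1\to\Gamma]$. For $a\in G_1$ let $c_a$ be the automorphism of $[G_2\to G_1]$ given by $g\mapsto a^{-1}ga$ and $\alpha\mapsto\alpha^a$; two elements $x,y$ of $\mathrm{Hom}_{\mathrm{Ho}(\mathbf{2Gp})}(\Gamma,[G_2\to G_1])$ are conjugate if $y=c_a\circ x$ for some $a\in G_1$. For positive integers $m,n$, let $\mathrm{PGL}(m,n)$ be the crossed module $[\mathbb{C}^*\to G_{m,n}]$, where $G_{m,n}$ is the group of algebraic automorphisms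 of $\mathbb{C}^2\setminus\{0\}$ that commute with the action $t\cdot(x,y)=(t^mx,t^ny)$ of $\mathbb{C}^*$, the map $\mathbb{C}^*\to G_{m,n}$ is given by this action, and $G_{m,n}$ acts trivially on $\mathbb{C}^*$. Proposition. Let $m\neq n$ be positive integers and $d=\gcd(m,n)$. Let $\Gamma$ be a discrete group; if $m\mid n$ or $n\mid m$, assume that $\Gamma$ is finite. Then the set of conjugacy classes of elements of $\mathrm{Hom}_{\mathrm{Ho}(\mathbf{2Gp})}(\Gamma,\mathrm{PGL}(m,n))$ is in bijection with $$\mathrm{Hom}(\Gamma,\mathbb{C}^*)\times H^2(\Gamma,\mu_d),$$ where $\mu_d\subset\mathbb{C}^*$ is the group of $d$-th roots of unity with trivial $\Gamma$-action. For fixed $m,n$ these bijections can be chosen natural in $\Gamma$ (with respect to homomorphisms between groups $\Gamma$ of the kind considered). -/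

import Mathlib

open CategoryTheory

universe u

/-! ## Crossed modules (2-groups) -/

/-- A crossed module `[φ : G₂ → G₁]`: a homomorphism of groups with a right action of `G₁` on `G₂`
(written `act (op g) α = α ^ g`) lifting the conjugation action of `G₁` on the image of `φ` and
descending the conjugation action of `G₂` on itself.  Crossed modules and 2-groups (group objects
in groupoids) form equivalent categories. -/
structure CrossedMod : Type (u + 1) where
  /-- the group `G₁` (of objects) -/
  G₁ : Type u
  /-- the group `G₂` (of arrows out of the identity object) -/
  G₂ : Type u
  [group₁ : Group G₁]
  [group₂ : Group G₂]
  /-- the structure map -/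
  φ : G₂ →* G₁
  /-- the right action of `G₁` on `G₂` -/
  act : G₁ᵐᵒᵖ →* MulAut G₂
  φ_act : ∀ (g : G₁) (α : G₂), φ (act (MulOpposite.op g) α) = g⁻¹ * φ α * g
  act_φ : ∀ α β : G₂, act (MulOpposite.op (φ β)) α = β⁻¹ * α * β

namespace CrossedMod

attribute [instance] CrossedMod.group₁ CrossedMod.group₂

/-- A strict morphism of crossed modules. -/
@[ext]
structure Hom (G H : CrossedMod.{u}) : Type u where
  hom₁ : G.G₁ →* H.G₁
  hom₂ : G.G₂ →* H.G₂
  comm : ∀ α : G.G₂, hom₁ (G.φ α) = H.φ (hom₂ α)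
  equivariant : ∀ (g : G.G₁) (α : G.G₂),
    hom₂ (G.act (MulOpposite.op g) α) = H.act (MulOpposite.op (hom₁ g)) (hom₂ α)

/-- The category of crossed modules and strict morphisms. -/
instance : Category CrossedMod.{u} where
  Hom := Hom
  id G :=
    { hom₁ := MonoidHom.id _
      hom₂ := MonoidHom.id _
      comm := fun _ => rfl
      equivariant := fun _ _ => rfl }
  comp f g :=
    { hom₁ := g.hom₁.comp f.hom₁
      hom₂ := g.hom₂.comp f.hom₂
      comm := fun α => by simp [f.comm, g.comm]
      equivariant := fun a α => by simp [f.equivariant, g.equivariant] }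

instance range_normal (G : CrossedMod.{u}) : G.φ.range.Normal where
  conj_mem := by
    rintro _ ⟨α, rfl⟩ g
    exact ⟨G.act (MulOpposite.op g⁻¹) α, by rw [G.φ_act, inv_inv]⟩

/-- `π₁ = G₁ / φ(G₂)`. -/
abbrev π₁ (G : CrossedMod.{u}) : Type u := G.G₁ ⧸ G.φ.range

/-- `π₂ = ker φ`. -/
abbrev π₂ (G : CrossedMod.{u}) : Type u := G.φ.ker

/-- The homomorphism induced on `π₁`. -/
def π₁Map {G H : CrossedMod.{u}} (f : G ⟶ H) : G.π₁ →* H.π₁ :=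
  QuotientGroup.map _ _ (Hom.hom₁ f) (by
    rintro _ ⟨α, rfl⟩
    exact ⟨Hom.hom₂ f α, (Hom.comm f α).symm⟩)

/-- The homomorphism induced on `π₂`. -/
def π₂Map {G H : CrossedMod.{u}} (f : G ⟶ H) : G.π₂ →* H.π₂ :=
  ((Hom.hom₂ f).comp G.φ.ker.subtype).codRestrict H.φ.ker (by
    rintro ⟨α, hα⟩
    rw [MonoidHom.mem_ker] at hα ⊢
    have h := Hom.comm f α
    rw [hα, map_one] at h
    exact h.symm)

/-- Equivalences: the morphisms that induce isomorphisms on `π₁` and `π₂`. -/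
def equivalences : MorphismProperty CrossedMod.{u} := fun _ _ f =>
  Function.Bijective (π₁Map f) ∧ Function.Bijective (π₂Map f)

/-- The homotopy category of 2-groups: equivalences are formally inverted. -/
abbrev Ho : Type (u + 1) := (equivalences.{u}).Localization

/-- The localization functor to the homotopy category. -/
abbrev toHo : CrossedMod.{u} ⥤ Ho.{u} := (equivalences.{u}).Q

/-- A discrete group `Γ` as the crossed module `[1 → Γ]`. -/
def ofGroup (Γ : Type u) [Group Γ] : CrossedMod.{u} where
  G₁ := Γ
  G₂ := PUnit.{u + 1}
  φ := 1
  act := 1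
  φ_act _ _ := by simp
  act_φ _ _ := rfl

/-- A homomorphism of groups as a morphism of crossed modules. -/
def ofGroupHom {Γ Γ' : Type u} [Group Γ] [Group Γ'] (f : Γ' →* Γ) :
    ofGroup Γ' ⟶ ofGroup Γ :=
  Hom.mk (G := ofGroup Γ') (H := ofGroup Γ) f (MonoidHom.id PUnit.{u + 1})
    (fun _ => map_one f) (fun _ _ => rfl)

/-- Homotopy classes of maps from a group `Γ` to `G`, i.e. morphisms in the homotopy category. -/
abbrev HoHom (Γ : Type u) [Group Γ] (G : CrossedMod.{u}) : Type (u + 1) :=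
  toHo.obj (ofGroup Γ) ⟶ toHo.obj G

/-- Conjugation by `a ∈ G₁`: the endomorphism `g ↦ a⁻¹ g a`, `α ↦ α ^ a`. -/
def conj (G : CrossedMod.{u}) (a : G.G₁) : G ⟶ G :=
  Hom.mk (G := G) (H := G) (MulAut.conj a⁻¹).toMonoidHom
    (G.act (MulOpposite.op a)).toMonoidHom
    (fun α => by simp [G.φ_act])
    (fun g α => by
      have h : ∀ x y : G.G₁, ∀ β : G.G₂, G.act (MulOpposite.op x) (G.act (MulOpposite.op y) β) =
          G.act (MulOpposite.op (y * x)) β := fun x y β => by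
        rw [MulOpposite.op_mul, map_mul]; rfl
      change G.act (MulOpposite.op a) (G.act (MulOpposite.op g) α) =
        G.act (MulOpposite.op (a⁻¹ * g * a⁻¹⁻¹)) (G.act (MulOpposite.op a) α)
      rw [h, h]
      congr 3
      group)

theorem conj_one (G : CrossedMod.{u}) : G.conj 1 = 𝟙 G := by
  apply Hom.ext
  · ext g
    change (1 : G.G₁)⁻¹ * g * (1 : G.G₁)⁻¹⁻¹ = g
    simp
  · ext α
    change G.act (MulOpposite.op 1) α = α
    simp

theorem conj_comp (G : CrossedMod.{u}) (a b : G.G₁) : G.conj a ≫ G.conj b = G.conj (a * b) := by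
  apply Hom.ext
  · ext g
    change b⁻¹ * (a⁻¹ * g * a⁻¹⁻¹) * b⁻¹⁻¹ = (a * b)⁻¹ * g * (a * b)⁻¹⁻¹
    simp [mul_assoc]
  · ext α
    change G.act (MulOpposite.op b) (G.act (MulOpposite.op a) α) = G.act (MulOpposite.op (a * b)) α
    rw [MulOpposite.op_mul, map_mul]
    rfl

/-- Two homotopy classes of maps `Γ → G` are conjugate if one is obtained from the other by
composing with the conjugation by some `a ∈ G₁`. -/
def conjSetoid (Γ : Type u) [Group Γ] (G : CrossedMod.{u}) : Setoid (HoHom Γ G) where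
  r x y := ∃ a : G.G₁, y = x ≫ toHo.map (G.conj a)
  iseqv :=
    { refl := fun x => ⟨1, by rw [conj_one, CategoryTheory.Functor.map_id, Category.comp_id]⟩
      symm := by
        rintro x _ ⟨a, rfl⟩
        refine ⟨a⁻¹, ?_⟩
        rw [Category.assoc, ← CategoryTheory.Functor.map_comp, conj_comp, mul_inv_cancel, conj_one,
          CategoryTheory.Functor.map_id, Category.comp_id]
      trans := by
        rintro x _ _ ⟨a, rfl⟩ ⟨b, rfl⟩
        refine ⟨a * b, ?_⟩
        rw [Category.assoc, ← CategoryTheory.Functor.map_comp, conj_comp] }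

/-- The set of conjugacy classes of homotopy classes of maps `Γ → G`. -/
def HoConjClasses (Γ : Type u) [Group Γ] (G : CrossedMod.{u}) : Type (u + 1) :=
  Quotient (conjSetoid Γ G)

/-- Precomposition of conjugacy classes with a homomorphism of groups `f : Γ' → Γ`. -/
noncomputable def HoConjClasses.pullback {Γ Γ' : Type u} [Group Γ] [Group Γ'] {G : CrossedMod.{u}}
    (f : Γ' →* Γ) : HoConjClasses Γ G → HoConjClasses Γ' G :=
  Quotient.map (fun x : HoHom Γ G => (toHo.map (ofGroupHom f) ≫ x : HoHom Γ' G)) (by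
    rintro x _ ⟨a, rfl⟩
    exact ⟨a, (Category.assoc _ _ _).symm⟩)

end CrossedMod

/-! ## The weighted projective general linear 2-group -/

namespace WeightedProjective

/-- `ℂ^r - {0}`. -/
abbrev Punctured (r : ℕ) : Type := {x : Fin r → ℂ // x ≠ 0}

/-- A function on the variety `ℂ^r - {0}` is regular at `p` if on a Zariski open neighbourhood of
`p` it is a quotient of polynomials. -/
def RegularAt {r : ℕ} (f : Punctured r → ℂ) (p : Punctured r) : Prop :=
  ∃ P Q : MvPolynomial (Fin r) ℂ, MvPolynomial.eval p.1 Q ≠ 0 ∧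
    ∀ x : Punctured r, MvPolynomial.eval x.1 Q ≠ 0 →
      f x = MvPolynomial.eval x.1 P / MvPolynomial.eval x.1 Q

/-- Algebraic maps `ℂ^r - {0} → ℂ^r - {0}`: all coordinates are regular at all points. -/
def IsAlgebraic {r : ℕ} (f : Punctured r → Punctured r) : Prop :=
  ∀ (i : Fin r) (p : Punctured r), RegularAt (fun x => (f x).1 i) p

theorem regularAt_polynomial {r : ℕ} (P : MvPolynomial (Fin r) ℂ) (p : Punctured r) :
    RegularAt (fun x => MvPolynomial.eval x.1 P) p :=
  ⟨P, 1, by simp, fun x _ => by simp⟩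

theorem RegularAt.add {r : ℕ} {f g : Punctured r → ℂ} {p : Punctured r}
    (hf : RegularAt f p) (hg : RegularAt g p) : RegularAt (fun x => f x + g x) p := by
  obtain ⟨A, B, hB, h⟩ := hf
  obtain ⟨C, D, hD, k⟩ := hg
  refine ⟨A * D + B * C, B * D, by simp [hB, hD], fun x hx => ?_⟩
  rw [map_mul, mul_ne_zero_iff] at hx
  simp only [h x hx.1, k x hx.2, map_add, map_mul]
  rw [div_add_div _ _ hx.1 hx.2]

theorem RegularAt.mul {r : ℕ} {f g : Punctured r → ℂ} {p : Punctured r}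
    (hf : RegularAt f p) (hg : RegularAt g p) : RegularAt (fun x => f x * g x) p := by
  obtain ⟨A, B, hB, h⟩ := hf
  obtain ⟨C, D, hD, k⟩ := hg
  refine ⟨A * C, B * D, by simp [hB, hD], fun x hx => ?_⟩
  rw [map_mul, mul_ne_zero_iff] at hx
  simp only [h x hx.1, k x hx.2, map_mul]
  rw [div_mul_div_comm]

theorem IsAlgebraic.regularAt_eval {r : ℕ} {f : Punctured r → Punctured r} (hf : IsAlgebraic f)
    (P : MvPolynomial (Fin r) ℂ) (p : Punctured r) :
    RegularAt (fun x => MvPolynomial.eval (f x).1 P) p := by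
  induction P using MvPolynomial.induction_on with
  | C a => simpa using regularAt_polynomial (MvPolynomial.C a) p
  | add P Q hP hQ => simpa using hP.add hQ
  | mul_X P i hP => simpa using hP.mul (hf i p)

theorem IsAlgebraic.comp {r : ℕ} {f g : Punctured r → Punctured r} (hf : IsAlgebraic f)
    (hg : IsAlgebraic g) : IsAlgebraic (fun x => f (g x)) := by
  intro i p
  obtain ⟨P, Q, hQ, h⟩ := hf i (g p)
  obtain ⟨A, B, hB, hA⟩ := hg.regularAt_eval P p
  obtain ⟨C, D, hD, hC⟩ := hg.regularAt_eval Q p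
  have hCp : MvPolynomial.eval p.1 C ≠ 0 := fun h0 => hQ ((hC p hD).trans (by rw [h0, zero_div]))
  refine ⟨A * D * D, B * D * C, by simp [hB, hCp, hD], fun x hx => ?_⟩
  rw [map_mul, map_mul, mul_ne_zero_iff, mul_ne_zero_iff] at hx
  obtain ⟨⟨hBx, hDx⟩, hCx⟩ := hx
  have hQx : MvPolynomial.eval (g x).1 Q ≠ 0 := by
    exact fun h0 => div_ne_zero hCx hDx ((hC x hDx).symm.trans h0)
  refine (h (g x) hQx).trans ?_
  have e₁ : MvPolynomial.eval (g x).1 P = _ := hA x hBx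
  have e₂ : MvPolynomial.eval (g x).1 Q = _ := hC x hDx
  rw [e₁, e₂, map_mul, map_mul, map_mul, map_mul]
  field_simp

theorem isAlgebraic_id (r : ℕ) : IsAlgebraic (fun x : Punctured r => x) := fun i p => by
  simpa using regularAt_polynomial (MvPolynomial.X i) p

/-- The action of `ℂˣ` on `ℂ^r - {0}` of weight `w`: `t` multiplies the `i`-th coordinate
by `t ^ w i`. -/
def weightedAction {r : ℕ} (w : Fin r → ℕ) : ℂˣ →* Equiv.Perm (Punctured r) :=
  MonoidHom.toHomPerm
    { toFun := fun t x => ⟨fun i => (t : ℂ) ^ w i * x.1 i, fun h => x.2 (by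
        funext i
        have hi := congrFun h i
        simpa using hi)⟩
      map_one' := by
        funext x
        apply Subtype.ext
        funext i
        change ((1 : ℂˣ) : ℂ) ^ w i * x.1 i = x.1 i
        simp
      map_mul' := fun s t => by
        funext x
        apply Subtype.ext
        funext i
        change ((s * t : ℂˣ) : ℂ) ^ w i * x.1 i = (s : ℂ) ^ w i * ((t : ℂ) ^ w i * x.1 i)
        rw [Units.val_mul, mul_pow, mul_assoc] }

theorem weightedAction_apply {r : ℕ} (w : Fin r → ℕ) (t : ℂˣ) (x : Punctured r) (i : Fin r) :
    (weightedAction w t x).1 i = (t : ℂ) ^ w i * x.1 i := rfl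

/-- The group of algebraic automorphisms of `ℂ^r - {0}` that are equivariant for the action
of `ℂˣ` of weight `w`. -/
def equivariantAut {r : ℕ} (w : Fin r → ℕ) : Subgroup (Equiv.Perm (Punctured r)) where
  carrier := {f | IsAlgebraic f ∧ IsAlgebraic f.symm ∧
    ∀ (t : ℂˣ) (x : Punctured r), f (weightedAction w t x) = weightedAction w t (f x)}
  one_mem' := ⟨isAlgebraic_id r, isAlgebraic_id r, fun _ _ => rfl⟩
  mul_mem' := by
    rintro f g ⟨hf, hf', hf''⟩ ⟨hg, hg', hg''⟩
    refine ⟨hf.comp hg, hg'.comp hf', fun t x => ?_⟩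
    simp [hf'', hg'']
  inv_mem' := by
    rintro f ⟨hf, hf', hf''⟩
    refine ⟨hf', hf, fun t x => ?_⟩
    change f.symm _ = weightedAction w t (f.symm x)
    rw [Equiv.symm_apply_eq, hf'', Equiv.apply_symm_apply]

theorem isAlgebraic_weightedAction {r : ℕ} (w : Fin r → ℕ) (t : ℂˣ) :
    IsAlgebraic (weightedAction w t) := fun i p =>
  ⟨MvPolynomial.C ((t : ℂ) ^ w i) * MvPolynomial.X i, 1, by simp,
    fun x _ => by simp [weightedAction_apply]⟩

theorem weightedAction_mem {r : ℕ} (w : Fin r → ℕ) (t : ℂˣ) :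
    weightedAction w t ∈ equivariantAut w := by
  refine ⟨isAlgebraic_weightedAction w t, ?_, fun s x => ?_⟩
  · have h : (weightedAction w t).symm = weightedAction w t⁻¹ := by
      rw [map_inv]
      rfl
    rw [h]
    exact isAlgebraic_weightedAction w t⁻¹
  · rw [← Equiv.Perm.mul_apply, ← Equiv.Perm.mul_apply, ← map_mul, ← map_mul, mul_comm]

/-- The weighted projective general linear 2-group `PGL(w₁, …, w_r)`: the crossed module
`[ℂˣ → equivariantAut w]` given by the weighted action, with trivial action on `ℂˣ`. -/
def PGL {r : ℕ} (w : Fin r → ℕ) : CrossedMod.{0} where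
  G₁ := equivariantAut w
  G₂ := ℂˣ
  φ := (weightedAction w).codRestrict (equivariantAut w) (weightedAction_mem w)
  act := 1
  φ_act g t := by
    apply Subtype.ext
    apply Equiv.ext
    intro x
    change weightedAction w t x = g.1.symm (weightedAction w t (g.1 x))
    rw [Equiv.eq_symm_apply]
    exact g.2.2.2 t x
  act_φ α β := by simp [mul_comm]

end WeightedProjective

/-! ## Second cohomology with coefficients in roots of unity -/

/-- `H²(Γ, μ_d)`, with `μ_d ⊆ ℂˣ` the group of `d`-th roots of unity with trivial action. -/
abbrev H2RootsOfUnity (Γ : Type) [Group Γ] (d : ℕ) : Type :=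
  groupCohomology (Rep.trivial ℤ Γ (Additive (rootsOfUnity d ℂ))) 2

/-- The map `H²(Γ, μ_d) → H²(Γ', μ_d)` induced by a homomorphism `f : Γ' → Γ`. -/
noncomputable def H2RootsOfUnity.pullback {Γ Γ' : Type} [Group Γ] [Group Γ'] {d : ℕ}
    (f : Γ' →* Γ) (c : H2RootsOfUnity Γ d) : H2RootsOfUnity Γ' d :=
  (groupCohomology.map (A := Rep.trivial ℤ Γ (Additive (rootsOfUnity d ℂ)))
    (B := Rep.trivial ℤ Γ' (Additive (rootsOfUnity d ℂ))) f
    (𝟙 (Rep.trivial ℤ Γ' (Additive (rootsOfUnity d ℂ)))) 2).hom c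

/-! A morphism `Γ → G` of the homotopy category is a weak homomorphism up to isomorphism: a map `Γ →
G₁` that is multiplicative up to a coherent `G₂`-valued defect (`Cocycle`). Such an `x` defines an
extension `E` of `Γ` by `G₂` and a span `Γ ← [G₂ → E] → G` whose left leg is an equivalence, hence a
morphism `toHoHom x`. Conversely, isomorphism classes of weak homomorphisms are a functor of `G`
that inverts equivalences, so morphisms of the homotopy category act on them; acting on the identity
of `Γ` gives the inverse construction (`ofHoHom_toHoHom`, `classToHoHom_ofHoHom`).

Let `w i < w j` be the weights. Regular functions on the punctured plane are polynomials, so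
comparing weights shows that an equivariant automorphism has the form `x_i ↦ a x_i`, `x_j ↦ b x_j +
c x_i ^ k` with `k = w j / w i`, and `c = 0` unless `w i ∣ w j` (`exists_form`). The group `ℂˣ` maps
to the diagonal torus by `t ↦ (t ^ w i, t ^ w j)`. With `w i = d p` and `w j = d q`, a unimodular
change of coordinates turns this into `t ↦ (1, t ^ d)`, so the diagonal part of `PGL w` is `kummer
d`. As `d`-th roots exist in `ℂˣ`, the factor given by `t ↦ t ^ d` is equivalent to `[μ_d → 1]`; so
weak homomorphisms to `kummer d` are classified by a character and a class in `H²(Γ, μ_d)`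
(`Kummer.invariant_eq_iff`, `Kummer.exists_invariant_eq`).

It remains to see that every weak homomorphism to `PGL w` is conjugate to a diagonal one
(`exists_conj_eq_diag`). If `w i ∣ w j`, then `c / b` is a crossed homomorphism for the character `a
^ k / b`; for finite `Γ` averaging makes it principal, and conjugation by a shear removes it. The
projection `toKummer` does not see conjugation and is a retraction of `ofKummer`, whence the
bijection. It is natural because roots and Bézout coefficients are chosen independently of `Γ`. -/

namespace CrossedMod

/-! ### Weak homomorphisms from a group to a crossed module -/

/-- The right action `α ^ g` of a crossed module. -/
def ract (G : CrossedMod.{u}) (α : G.G₂) (g : G.G₁) : G.G₂ := G.act (MulOpposite.op g) α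

section ract

variable (G : CrossedMod.{u})

theorem ract_one (α : G.G₂) : G.ract α 1 = α := by simp [ract]

theorem one_ract (g : G.G₁) : G.ract 1 g = 1 := by simp [ract]

theorem ract_ract (α : G.G₂) (g h : G.G₁) : G.ract (G.ract α g) h = G.ract α (g * h) := by
  simp [ract]

theorem mul_ract (α β : G.G₂) (g : G.G₁) : G.ract (α * β) g = G.ract α g * G.ract β g := by
  simp [ract]

theorem inv_ract (α : G.G₂) (g : G.G₁) : G.ract α⁻¹ g = (G.ract α g)⁻¹ := by
  simp [ract]

theorem φ_ract (α : G.G₂) (g : G.G₁) : G.φ (G.ract α g) = g⁻¹ * G.φ α * g := G.φ_act g α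

theorem ract_φ (α β : G.G₂) : G.ract α (G.φ β) = β⁻¹ * α * β := G.act_φ α β

variable {G} {H : CrossedMod.{u}}

theorem hom₂_ract (w : G ⟶ H) (α : G.G₂) (g : G.G₁) :
    Hom.hom₂ w (G.ract α g) = H.ract (Hom.hom₂ w α) (Hom.hom₁ w g) := Hom.equivariant w g α

end ract

/-- A weak homomorphism from a group `Γ` to a crossed module: a map `Γ → G₁` which is
multiplicative up to a coherent `G₂`-valued defect. -/
@[ext]
structure Cocycle (Γ : Type u) [Group Γ] (G : CrossedMod.{u}) : Type u where
  obj : Γ → G.G₁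
  arr : Γ → Γ → G.G₂
  obj_mul : ∀ g h, obj g * obj h = obj (g * h) * G.φ (arr g h)
  assoc : ∀ g h k, arr (g * h) k * G.ract (arr g h) (obj k) = arr g (h * k) * arr h k

namespace Cocycle

variable {Γ Γ' : Type u} [Group Γ] [Group Γ'] {G H : CrossedMod.{u}}

theorem obj_one (x : Cocycle Γ G) : x.obj 1 = G.φ (x.arr 1 1) := by
  have := x.obj_mul 1 1
  rw [mul_one] at this
  exact mul_left_cancel this

theorem arr_one (x : Cocycle Γ G) (g : Γ) : x.arr g 1 = x.arr 1 1 := by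
  have h := x.assoc g 1 1
  rw [mul_one, mul_one, mul_left_cancel_iff, x.obj_one, ract_φ] at h
  calc x.arr g 1 = x.arr 1 1 * ((x.arr 1 1)⁻¹ * x.arr g 1 * x.arr 1 1) * (x.arr 1 1)⁻¹ := by group
    _ = x.arr 1 1 := by rw [h]; group

theorem one_arr (x : Cocycle Γ G) (g : Γ) : x.arr 1 g = G.ract (x.arr 1 1) (x.obj g) := by
  have h := x.assoc 1 1 g
  rw [one_mul, one_mul] at h
  exact (mul_left_cancel h).symm

/-- `a` is an isomorphism of weak homomorphisms from `x` to `y`. -/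
def IsIso (x y : Cocycle Γ G) (a : Γ → G.G₂) : Prop :=
  (∀ g, y.obj g = x.obj g * G.φ (a g)) ∧
    ∀ g h, a (g * h) * y.arr g h = x.arr g h * G.ract (a g) (x.obj h) * a h

theorem IsIso.refl (x : Cocycle Γ G) : IsIso x x 1 :=
  ⟨fun g => by simp, fun g h => by simp [one_ract]⟩

theorem IsIso.symm {x y : Cocycle Γ G} {a : Γ → G.G₂} (h : IsIso x y a) :
    IsIso y x (fun g => (a g)⁻¹) := by
  refine ⟨fun g => by rw [h.1]; simp, fun g k => ?_⟩
  have e := h.2 g k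
  rw [h.1 k, ← ract_ract, ract_φ, inv_ract]
  rw [inv_mul_eq_iff_eq_mul, ← mul_assoc, ← mul_assoc, e]
  group

theorem IsIso.trans {x y z : Cocycle Γ G} {a b : Γ → G.G₂} (h : IsIso x y a) (k : IsIso y z b) :
    IsIso x z (fun g => a g * b g) := by
  refine ⟨fun g => by rw [k.1, h.1, map_mul, mul_assoc], fun s t => ?_⟩
  have e := h.2 s t
  have e' := k.2 s t
  rw [h.1 t, ← ract_ract, ract_φ] at e'
  rw [mul_assoc, e', ← mul_assoc, ← mul_assoc, e, mul_ract]
  group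

instance setoid (Γ : Type u) [Group Γ] (G : CrossedMod.{u}) : Setoid (Cocycle Γ G) where
  r x y := ∃ a, IsIso x y a
  iseqv :=
    { refl := fun x => ⟨1, .refl x⟩
      symm := fun ⟨_, h⟩ => ⟨_, h.symm⟩
      trans := fun ⟨_, h⟩ ⟨_, k⟩ => ⟨_, h.trans k⟩ }

/-- Composition with a strict morphism. -/
def map (w : G ⟶ H) (x : Cocycle Γ G) : Cocycle Γ H where
  obj g := Hom.hom₁ w (x.obj g)
  arr g h := Hom.hom₂ w (x.arr g h)
  obj_mul g h := by rw [← map_mul, x.obj_mul, map_mul, Hom.comm]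
  assoc g h k := by rw [← hom₂_ract, ← map_mul, x.assoc, map_mul]

/-- Restriction along a homomorphism of groups. -/
def comap (f : Γ' →* Γ) (x : Cocycle Γ G) : Cocycle Γ' G where
  obj g := x.obj (f g)
  arr g h := x.arr (f g) (f h)
  obj_mul g h := by rw [x.obj_mul, map_mul]
  assoc g h k := by rw [map_mul, x.assoc, map_mul]

theorem IsIso.map (w : G ⟶ H) {x y : Cocycle Γ G} {a : Γ → G.G₂} (h : IsIso x y a) :
    IsIso (x.map w) (y.map w) (fun g => Hom.hom₂ w (a g)) := by
  refine ⟨fun g => ?_, fun g k => ?_⟩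
  · change Hom.hom₁ w (y.obj g) = _
    rw [h.1, map_mul, Hom.comm]; rfl
  · change Hom.hom₂ w _ * Hom.hom₂ w (y.arr g k) = _
    rw [← map_mul, h.2, map_mul, map_mul, hom₂_ract]; rfl

theorem IsIso.comap (f : Γ' →* Γ) {x y : Cocycle Γ G} {a : Γ → G.G₂} (h : IsIso x y a) :
    IsIso (x.comap f) (y.comap f) (fun g => a (f g)) :=
  ⟨fun g => h.1 _, fun g k => by
    change a (f (g * k)) * _ = _
    rw [map_mul]
    exact h.2 _ _⟩

/-- The identity of `Γ` as a weak homomorphism. -/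
def id (Γ : Type u) [Group Γ] : Cocycle Γ (ofGroup Γ) where
  obj g := g
  arr _ _ := 1
  obj_mul g h := (mul_one (M := Γ) (g * h)).symm
  assoc _ _ _ := rfl

variable (Γ) in
/-- Isomorphism classes of weak homomorphisms, as a functor of the target. -/
def functor : CrossedMod.{u} ⥤ Type u where
  obj G := Quotient (setoid Γ G)
  map w := TypeCat.ofHom (Quotient.map (map w) (fun _ _ ⟨_, h⟩ => ⟨_, h.map w⟩))
  map_id G := by
    ext x
    induction x using Quotient.inductionOn
    rfl
  map_comp v w := by
    ext x
    induction x using Quotient.inductionOn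
    rfl

end Cocycle

/-! ### Equivalences act bijectively on classes of weak homomorphisms -/

/-- The last two conditions say that `G.G₂` is the fibre product of `G.G₁` and `H.G₂` over `H.G₁`.
In this form lifts are chosen elementwise, and equations in `G.G₂` are checked after applying `φ`
and `hom₂`. -/
theorem equivalences_iff {G H : CrossedMod.{u}} (w : G ⟶ H) :
    equivalences w ↔ (∀ h : H.G₁, ∃ x β, Hom.hom₁ w x = h * H.φ β) ∧
      (∀ x β, Hom.hom₁ w x = H.φ β → ∃ b, G.φ b = x ∧ Hom.hom₂ w b = β) ∧
      ∀ b b', G.φ b = G.φ b' → Hom.hom₂ w b = Hom.hom₂ w b' → b = b' := by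
  have hcomm : ∀ b, Hom.hom₁ w (G.φ b) = H.φ (Hom.hom₂ w b) := Hom.comm w
  constructor
  · rintro ⟨⟨i₁, s₁⟩, i₂, s₂⟩
    rw [injective_iff_map_eq_one] at i₁ i₂
    have inj : ∀ b, G.φ b = 1 → Hom.hom₂ w b = 1 → b = 1 := fun b hb hw =>
      congrArg Subtype.val (i₂ ⟨b, hb⟩ (Subtype.ext hw))
    refine ⟨fun h => ?_, fun x β hx => ?_, fun b b' h k => ?_⟩
    · obtain ⟨x, hx⟩ := s₁ (QuotientGroup.mk h)
      induction x using QuotientGroup.induction_on with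
      | H x =>
        have hx' : (QuotientGroup.mk (Hom.hom₁ w x) : H.π₁) = QuotientGroup.mk h := hx
        obtain ⟨β, hβ⟩ := QuotientGroup.eq.1 hx'.symm
        exact ⟨x, β, by rw [hβ]; group⟩
    · have h1 : (QuotientGroup.mk x : G.π₁) = 1 := by
        apply i₁
        exact (QuotientGroup.eq_one_iff _).2 ⟨β, hx.symm⟩
      obtain ⟨b, rfl⟩ := (QuotientGroup.eq_one_iff _).1 h1
      have hk : (Hom.hom₂ w b)⁻¹ * β ∈ H.φ.ker := by
        rw [MonoidHom.mem_ker, map_mul, map_inv, ← hx, hcomm]; simp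
      obtain ⟨⟨z, hz⟩, e⟩ := s₂ ⟨_, hk⟩
      have e' : Hom.hom₂ w z = (Hom.hom₂ w b)⁻¹ * β := congrArg Subtype.val e
      rw [MonoidHom.mem_ker] at hz
      exact ⟨b * z, by rw [map_mul, hz, mul_one], by rw [map_mul, e']; group⟩
    · exact mul_inv_eq_one.1 (inj (b * b'⁻¹) (by simp [h]) (by simp [k]))
  · rintro ⟨s, l, i⟩
    refine ⟨⟨?_, fun h => ?_⟩, ?_, ?_⟩
    · rw [injective_iff_map_eq_one]
      intro x hx
      induction x using QuotientGroup.induction_on with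
      | H x =>
        have hx' : (QuotientGroup.mk (Hom.hom₁ w x) : H.π₁) = 1 := hx
        obtain ⟨β, hβ⟩ := (QuotientGroup.eq_one_iff _).1 hx'
        obtain ⟨b, hb, -⟩ := l x β hβ.symm
        exact (QuotientGroup.eq_one_iff _).2 ⟨b, hb⟩
    · induction h using QuotientGroup.induction_on with
      | H h =>
        obtain ⟨x, β, e⟩ := s h
        refine ⟨QuotientGroup.mk x, ?_⟩
        change (QuotientGroup.mk (Hom.hom₁ w x) : H.π₁) = QuotientGroup.mk h
        refine (QuotientGroup.eq.2 ?_).symm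
        exact ⟨β, by rw [e]; group⟩
    · rw [injective_iff_map_eq_one]
      rintro ⟨b, hb⟩ h
      have h' : Hom.hom₂ w b = 1 := congrArg Subtype.val h
      rw [MonoidHom.mem_ker] at hb
      exact Subtype.ext (i b 1 (by rw [hb, map_one]) (by rw [h', map_one]))
    · rintro ⟨β, hβ⟩
      rw [MonoidHom.mem_ker] at hβ
      obtain ⟨b, hb, e⟩ := l 1 β (by rw [hβ, map_one])
      exact ⟨⟨b, hb⟩, Subtype.ext e⟩

namespace Cocycle

variable {Γ Γ' : Type u} [Group Γ] [Group Γ'] {G H : CrossedMod.{u}}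

variable (Γ) in
theorem functor_isInvertedBy : (equivalences.{u}).IsInvertedBy (functor Γ) := by
  intro G H w hw
  obtain ⟨s, l, i⟩ := (equivalences_iff w).1 hw
  rw [isIso_iff_bijective]
  constructor
  · intro x y
    induction x using Quotient.inductionOn with | h x
    induction y using Quotient.inductionOn with | h y
    intro hxy
    obtain ⟨a, ha₁, ha₂⟩ := Quotient.exact hxy
    have h : ∀ g, ∃ b, G.φ b = (x.obj g)⁻¹ * y.obj g ∧ Hom.hom₂ w b = a g := fun g => by
      refine l _ _ ?_
      rw [map_mul, map_inv, inv_mul_eq_iff_eq_mul]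
      exact ha₁ g
    choose b hb₁ hb₂ using h
    refine Quotient.sound ⟨b, fun g => by rw [hb₁]; group, fun g k => i _ _ ?_ ?_⟩
    · have ex := x.obj_mul g k
      have ey := y.obj_mul g k
      rw [map_mul, map_mul, map_mul, φ_ract, hb₁, hb₁, hb₁]
      rw [← eq_inv_mul_iff_mul_eq] at ex ey
      rw [ex, ey]
      group
    · rw [map_mul, map_mul, map_mul, hom₂_ract, hb₂, hb₂, hb₂]
      exact ha₂ g k
  · intro y
    induction y using Quotient.inductionOn with | h y
    have h : ∀ g, ∃ x β, Hom.hom₁ w x = y.obj g * H.φ β := fun g => s _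
    choose f β hf using h
    -- This is the defect of `y` transported along `β`, so that it belongs to `g ↦ hom₁ w (f g)`;
    -- its lift `c` is the defect of `f`.
    let d : Γ → Γ → H.G₂ := fun g k =>
      (β (g * k))⁻¹ * y.arr g k * H.ract (β g) (y.obj k) * β k
    have h : ∀ g k, ∃ c, G.φ c = (f (g * k))⁻¹ * (f g * f k) ∧ Hom.hom₂ w c = d g k :=
      fun g k => by
        refine l _ _ ?_
        have e := y.obj_mul g k
        rw [← eq_inv_mul_iff_mul_eq] at e
        simp only [d, map_mul, map_inv, hf, φ_ract, e]
        group
    choose c hc₁ hc₂ using h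
    let x : Cocycle Γ G :=
      { obj := f
        arr := c
        obj_mul := fun g k => by rw [hc₁]; group
        assoc := fun g h k => by
          refine i _ _ ?_ ?_
          · simp only [map_mul, hc₁, φ_ract, mul_assoc g h k]
            group
          · have e := y.assoc g h k
            simp only [map_mul, hom₂_ract, hc₂, hf, ← ract_ract, ract_φ, d, mul_ract, inv_ract,
              mul_assoc g h k] at e ⊢
            have e₂ : H.ract (H.ract (β g) (y.obj h)) (y.obj k) = (y.arr h k)⁻¹ *
                H.ract (β g) (y.obj (h * k)) * y.arr h k := by
              rw [ract_ract, y.obj_mul, ← ract_ract, ract_φ]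
            rw [e₂]
            rw [← eq_mul_inv_iff_mul_eq] at e
            rw [e]
            group }
    refine ⟨Quotient.mk _ x, Quotient.sound ⟨fun g => (β g)⁻¹, IsIso.symm (a := β) ⟨hf, ?_⟩⟩⟩
    intro g k
    change _ * Hom.hom₂ w (c g k) = _
    rw [hc₂]
    simp only [d, ← mul_assoc, mul_inv_cancel, one_mul]

/-! ### Extensions, and morphisms in the homotopy category -/

/-- The extension of `Γ` by `G₂` defined by a weak homomorphism. -/
@[ext]
structure Ext (x : Cocycle Γ G) : Type u where
  base : Γ
  fib : G.G₂

namespace Ext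

variable (x : Cocycle Γ G)

instance : Mul x.Ext where
  mul p q := ⟨p.base * q.base, x.arr p.base q.base * G.ract p.fib (x.obj q.base) * q.fib⟩

/-- Cocycles are not normalised, so the fibre of the unit is `(x.arr 1 1)⁻¹` and not `1`. -/
instance : One x.Ext where
  one := ⟨1, (x.arr 1 1)⁻¹⟩

instance : Inv x.Ext where
  inv p := ⟨p.base⁻¹, G.ract ((x.arr p.base⁻¹ p.base)⁻¹ * (x.arr 1 1)⁻¹ * p.fib⁻¹)
    (x.obj p.base)⁻¹⟩

theorem mul_base (p q : x.Ext) : (p * q).base = p.base * q.base := rfl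

theorem mul_fib (p q : x.Ext) :
    (p * q).fib = x.arr p.base q.base * G.ract p.fib (x.obj q.base) * q.fib := rfl

theorem one_base : (1 : x.Ext).base = 1 := rfl

theorem one_fib : (1 : x.Ext).fib = (x.arr 1 1)⁻¹ := rfl

theorem inv_base (p : x.Ext) : p⁻¹.base = p.base⁻¹ := rfl

theorem inv_fib (p : x.Ext) : p⁻¹.fib =
    G.ract ((x.arr p.base⁻¹ p.base)⁻¹ * (x.arr 1 1)⁻¹ * p.fib⁻¹) (x.obj p.base)⁻¹ := rfl

instance : Group x.Ext := Group.ofLeftAxioms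
  (fun p q r => by
    ext
    · simp only [mul_base, mul_assoc]
    · simp only [mul_fib, mul_base, mul_ract]
      have e := x.assoc p.base q.base r.base
      have e₂ : G.ract (G.ract p.fib (x.obj q.base)) (x.obj r.base) = (x.arr q.base r.base)⁻¹ *
          G.ract p.fib (x.obj (q.base * r.base)) * x.arr q.base r.base := by
        rw [ract_ract, x.obj_mul, ← ract_ract, ract_φ]
      rw [e₂]
      rw [← eq_mul_inv_iff_mul_eq] at e
      rw [e]
      group)
  (fun p => by
    ext
    · simp only [mul_base, one_base, one_mul]
    · rw [mul_fib, one_base, one_fib, x.one_arr p.base, inv_ract]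
      group)
  (fun p => by
    ext
    · simp only [mul_base, inv_base, one_base, inv_mul_cancel]
    · simp only [mul_fib, inv_base, inv_fib, one_fib, ract_ract, inv_mul_cancel, ract_one]
      group)

/-- The homomorphism from the extension to `G₁`. -/
def toG₁ : x.Ext →* G.G₁ := MonoidHom.mk' (fun p => x.obj p.base * G.φ p.fib) (fun p q => by
  simp only [mul_base, mul_fib, map_mul, φ_ract]
  have e := x.obj_mul p.base q.base
  rw [← eq_mul_inv_iff_mul_eq] at e
  rw [e]
  group)

theorem toG₁_apply (p : x.Ext) : toG₁ x p = x.obj p.base * G.φ p.fib := rfl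

/-- The inclusion of `G₂` in the extension. -/
def ofG₂ : G.G₂ →* x.Ext := MonoidHom.mk' (fun α => ⟨1, (x.arr 1 1)⁻¹ * α⟩) (fun α β => by
  ext
  · simp only [mul_base, mul_one]
  · simp only [mul_fib, x.obj_one, ract_φ]
    group)

theorem ofG₂_base (α : G.G₂) : (ofG₂ x α).base = 1 := rfl

theorem ofG₂_fib (α : G.G₂) : (ofG₂ x α).fib = (x.arr 1 1)⁻¹ * α := rfl

theorem toG₁_ofG₂ (α : G.G₂) : toG₁ x (ofG₂ x α) = G.φ α := by
  simp [toG₁_apply, ofG₂_base, ofG₂_fib, x.obj_one]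

theorem mul_ofG₂ (p : x.Ext) (α : G.G₂) : p * ofG₂ x α = ⟨p.base, p.fib * α⟩ := by
  ext
  · simp [mul_base, ofG₂_base]
  · simp only [mul_fib, ofG₂_base, ofG₂_fib, x.obj_one, x.arr_one, ract_φ]
    group

theorem ofG₂_mul (p : x.Ext) (α : G.G₂) :
    ofG₂ x α * p = ⟨p.base, G.ract α (x.obj p.base) * p.fib⟩ := by
  ext
  · simp [mul_base, ofG₂_base]
  · rw [mul_fib, ofG₂_base, ofG₂_fib, x.one_arr p.base, mul_ract, inv_ract]
    group

end Ext

/-- The crossed module `[G₂ → E]` given by the extension `E` of `Γ` by `G₂`. -/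
def extMod (x : Cocycle Γ G) : CrossedMod.{u} where
  G₁ := x.Ext
  G₂ := G.G₂
  φ := Ext.ofG₂ x
  act := G.act.comp (Ext.toG₁ x).op
  φ_act p α := by
    change Ext.ofG₂ x (G.ract α (Ext.toG₁ x p)) = _
    rw [mul_assoc, eq_inv_mul_iff_mul_eq, Ext.mul_ofG₂, Ext.ofG₂_mul, Ext.toG₁_apply, ← ract_ract,
      ract_φ]
    congr 1
    group
  act_φ α β := by
    change G.ract α (Ext.toG₁ x (Ext.ofG₂ x β)) = _
    rw [Ext.toG₁_ofG₂, ract_φ]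

/-- The projection of the extension to `Γ`. -/
def extProj (x : Cocycle Γ G) : x.extMod ⟶ ofGroup Γ :=
  Hom.mk (G := x.extMod) (H := ofGroup Γ)
    (MonoidHom.mk' (M := x.Ext) (G := Γ) (fun p => p.base) fun _ _ => rfl) 1
    (fun _ => rfl) (fun _ _ => rfl)

/-- The strict morphism from the extension to the target. -/
def extHom (x : Cocycle Γ G) : x.extMod ⟶ G :=
  Hom.mk (G := x.extMod) (H := G) (Ext.toG₁ x) (MonoidHom.id G.G₂)
    (fun α => Ext.toG₁_ofG₂ x α) (fun _ _ => rfl)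

/-- `G₂` embeds in the extension as the kernel of the surjection to `Γ`. -/
theorem equivalences_extProj (x : Cocycle Γ G) : equivalences x.extProj := by
  rw [equivalences_iff]
  refine ⟨fun h => ⟨(⟨h, 1⟩ : x.Ext), 1, (mul_one (M := Γ) h).symm⟩, fun p β h => ?_,
    fun b b' h _ => ?_⟩
  · have h' : Ext.base p = 1 := h
    refine ⟨x.arr 1 1 * Ext.fib p, ?_, rfl⟩
    apply Ext.ext
    · exact h'.symm
    · change (x.arr 1 1)⁻¹ * _ = _
      group
  · have h' : (x.arr 1 1)⁻¹ * (show G.G₂ from b) = (x.arr 1 1)⁻¹ * (show G.G₂ from b') := congrArg Ext.fib h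
    exact mul_left_cancel (G := G.G₂) h'

/-- The morphism in the homotopy category defined by a weak homomorphism. -/
noncomputable def toHoHom (x : Cocycle Γ G) : HoHom Γ G :=
  Localization.Construction.wInv x.extProj x.equivalences_extProj ≫ toHo.map x.extHom

theorem toHoHom_eq_iff (x : Cocycle Γ G) (t : HoHom Γ G) :
    x.toHoHom = t ↔ toHo.map x.extHom = toHo.map x.extProj ≫ t :=
  Iso.inv_comp_eq (Localization.Construction.wIso x.extProj x.equivalences_extProj)

theorem map_extProj_comp_toHoHom (x : Cocycle Γ G) :
    toHo.map x.extProj ≫ x.toHoHom = toHo.map x.extHom :=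
  ((x.toHoHom_eq_iff _).1 rfl).symm

/-- A morphism of extensions over a homomorphism `f` of groups and a strict morphism `w` shows
that the associated morphisms in the homotopy category agree. -/
theorem toHoHom_eq_of_hom {x : Cocycle Γ G} {y : Cocycle Γ' H} (f : ofGroup Γ ⟶ ofGroup Γ')
    (w : G ⟶ H) (e : x.extMod ⟶ y.extMod) (h₁ : e ≫ y.extProj = x.extProj ≫ f)
    (h₂ : e ≫ y.extHom = x.extHom ≫ w) :
    toHo.map f ≫ y.toHoHom = x.toHoHom ≫ toHo.map w := by
  have : toHo.map x.extProj ≫ toHo.map f ≫ y.toHoHom =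
      toHo.map x.extProj ≫ x.toHoHom ≫ toHo.map w := by
    rw [← Category.assoc, ← Category.assoc, map_extProj_comp_toHoHom, ← Functor.map_comp,
      ← Functor.map_comp, ← h₁, ← h₂, Functor.map_comp, Functor.map_comp, Category.assoc,
      map_extProj_comp_toHoHom]
  exact (cancel_epi (Localization.Construction.wIso x.extProj x.equivalences_extProj).hom).1 this

theorem toHoHom_map (x : Cocycle Γ G) (w : G ⟶ H) :
    (x.map w).toHoHom = x.toHoHom ≫ toHo.map w := by
  have := toHoHom_eq_of_hom (x := x) (y := x.map w) (𝟙 _) w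
    (Hom.mk (G := x.extMod) (H := (x.map w).extMod)
      (MonoidHom.mk' (M := x.Ext) (G := (x.map w).Ext) (fun p => ⟨p.base, Hom.hom₂ w p.fib⟩)
        fun p q => by
          apply Ext.ext
          · rfl
          · change Hom.hom₂ w (_ * _ * _) = Hom.hom₂ w _ * H.ract _ (Hom.hom₁ w _) * Hom.hom₂ w _
            rw [map_mul, map_mul, hom₂_ract])
      (Hom.hom₂ (G := G) (H := H) w : G.G₂ →* H.G₂)
      (fun α => by
        apply Ext.ext
        · rfl
        · let α' : G.G₂ := α
          change Hom.hom₂ w ((x.arr 1 1)⁻¹ * α') = (Hom.hom₂ w (x.arr 1 1))⁻¹ * Hom.hom₂ w α'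
          rw [map_mul, map_inv])
      (fun p α => by
        let α' : G.G₂ := α
        change Hom.hom₂ w (G.ract α' (x.obj p.base * G.φ p.fib)) =
          H.ract (Hom.hom₂ w α') (Hom.hom₁ w (x.obj p.base) * H.φ (Hom.hom₂ w p.fib))
        rw [hom₂_ract, map_mul, Hom.comm]))
    rfl
    (by
      apply Hom.ext
      · ext p
        change Hom.hom₁ w (x.obj p.base) * H.φ (Hom.hom₂ w p.fib) =
          Hom.hom₁ w (x.obj p.base * G.φ p.fib)
        rw [map_mul, Hom.comm]
      · rfl)
  rwa [CategoryTheory.Functor.map_id, Category.id_comp] at this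

theorem toHoHom_comap (x : Cocycle Γ G) (f : Γ' →* Γ) :
    (x.comap f).toHoHom = toHo.map (ofGroupHom f) ≫ x.toHoHom := by
  have := toHoHom_eq_of_hom (x := x.comap f) (y := x) (ofGroupHom f) (𝟙 G)
    (Hom.mk (G := (x.comap f).extMod) (H := x.extMod)
      (MonoidHom.mk' (M := (x.comap f).Ext) (G := x.Ext) (fun p => ⟨f p.base, p.fib⟩)
        fun p q => by
          apply Ext.ext
          · exact map_mul f _ _
          · rfl)
      (MonoidHom.id G.G₂)
      (fun α => by
        apply Ext.ext
        · exact map_one f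
        · change (x.arr (f 1) (f 1))⁻¹ * _ = (x.arr 1 1)⁻¹ * _
          rw [map_one]
          rfl)
      (fun p α => rfl))
    rfl rfl
  rw [CategoryTheory.Functor.map_id, Category.comp_id] at this
  exact this.symm

/-- The map `(g, α) ↦ (g, (a g)⁻¹ * α)` of extensions is compatible with both legs of the spans. -/
theorem toHoHom_eq_of_isIso {x y : Cocycle Γ G} {a : Γ → G.G₂} (h : IsIso x y a) :
    x.toHoHom = y.toHoHom := by
  have := toHoHom_eq_of_hom (x := x) (y := y) (𝟙 _) (𝟙 G)
    (Hom.mk (G := x.extMod) (H := y.extMod)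
      (MonoidHom.mk' (M := x.Ext) (G := y.Ext) (fun p => ⟨p.base, (a p.base)⁻¹ * p.fib⟩)
        fun p q => by
          apply Ext.ext
          · rfl
          · have e := h.2 p.base q.base
            rw [mul_assoc, ← eq_inv_mul_iff_mul_eq] at e
            simp only [Ext.mul_fib, Ext.mul_base, e, h.1, ← ract_ract, ract_φ, mul_ract, inv_ract]
            group)
      (MonoidHom.id G.G₂)
      (fun α => by
        apply Ext.ext
        · rfl
        · let α' : G.G₂ := α
          change (a 1)⁻¹ * ((x.arr 1 1)⁻¹ * α') = (y.arr 1 1)⁻¹ * α'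
          have e := h.2 1 1
          rw [x.obj_one, ract_φ, mul_one] at e
          have : y.arr 1 1 = x.arr 1 1 * a 1 := by
            apply mul_left_cancel (a := a 1)
            rw [e]
            group
          rw [this]
          group)
      (fun p α => by
        change G.ract α (x.obj p.base * G.φ p.fib) =
          G.ract α (y.obj p.base * G.φ ((a p.base)⁻¹ * p.fib))
        rw [h.1]
        simp [mul_assoc]))
    rfl
    (by
      apply Hom.ext
      · ext p
        change y.obj p.base * G.φ ((a p.base)⁻¹ * p.fib) = x.obj p.base * G.φ p.fib
        rw [h.1]
        simp [mul_assoc]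
      · rfl)
  rw [CategoryTheory.Functor.map_id, CategoryTheory.Functor.map_id, Category.comp_id, Category.id_comp] at this
  exact this.symm

theorem toHoHom_id : (id Γ).toHoHom = 𝟙 _ := by
  rw [toHoHom_eq_iff, Category.comp_id]
  congr 1
  apply Hom.ext
  · ext p
    change Ext.base p * (1 : Γ) = _
    rw [mul_one]
    rfl
  · rfl

/-- The tautological weak homomorphism to the extension. -/
def extSection (x : Cocycle Γ G) : Cocycle Γ x.extMod where
  obj g := (⟨g, 1⟩ : x.Ext)
  arr g h := x.arr g h
  obj_mul g h := by
    change (⟨g, 1⟩ * ⟨h, 1⟩ : x.Ext) = ⟨g * h, 1⟩ * Ext.ofG₂ x (x.arr g h)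
    rw [Ext.mul_ofG₂]
    ext
    · rfl
    · simp [Ext.mul_fib, one_ract]
  assoc g h k := by
    change x.arr (g * h) k * G.ract (x.arr g h) (x.obj k * G.φ 1) = _
    rw [map_one, mul_one]
    exact x.assoc g h k

theorem extSection_map_extProj (x : Cocycle Γ G) : x.extSection.map x.extProj = id Γ := rfl

theorem extSection_map_extHom (x : Cocycle Γ G) : x.extSection.map x.extHom = x := by
  ext g
  · change x.obj g * G.φ 1 = _
    rw [map_one, mul_one]
  · rfl

variable (Γ) in
/-- The extension of `functor Γ` to the homotopy category. -/
noncomputable def hoFunctor : Ho.{u} ⥤ Type u :=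
  Localization.Construction.lift (functor Γ) (functor_isInvertedBy Γ)

/-- The weak homomorphism, up to isomorphism, defined by a morphism in the homotopy category. -/
noncomputable def ofHoHom (t : HoHom Γ G) : Quotient (setoid Γ G) :=
  (hoFunctor Γ).map t (Quotient.mk _ (id Γ))

theorem hoFunctor_map_map (w : G ⟶ H) (x : Cocycle Γ G) :
    (hoFunctor Γ).map (toHo.map w) (Quotient.mk (setoid Γ G) x) =
      Quotient.mk (setoid Γ H) (x.map w) := by
  have := Functor.congr_hom
    (Localization.Construction.fac (functor Γ) (functor_isInvertedBy Γ)) w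
  exact ConcreteCategory.congr_hom this (Quotient.mk (setoid Γ G) x)

/-- The weak homomorphism `extSection` goes to `id Γ` along one leg of the span and to `x` along the
other. -/
theorem ofHoHom_toHoHom (x : Cocycle Γ G) : ofHoHom x.toHoHom = Quotient.mk _ x := by
  have h := hoFunctor_map_map x.extProj x.extSection
  rw [extSection_map_extProj] at h
  unfold ofHoHom
  have e : ∀ z, (hoFunctor Γ).map x.toHoHom ((hoFunctor Γ).map (toHo.map x.extProj) z) =
      (hoFunctor Γ).map (toHo.map x.extHom) z := fun z => by
    rw [← map_extProj_comp_toHoHom, Functor.map_comp]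
    rfl
  have := e (Quotient.mk (setoid Γ x.extMod) x.extSection)
  rw [h, hoFunctor_map_map, extSection_map_extHom] at this
  exact this

/-- The morphism in the homotopy category defined by an isomorphism class of weak
homomorphisms. -/
noncomputable def classToHoHom (q : Quotient (setoid Γ G)) : HoHom Γ G :=
  Quotient.lift toHoHom (fun x y (h : ∃ a, IsIso x y a) => h.elim fun _ h => toHoHom_eq_of_isIso h) q

/-- `classToHoHom` at an object of the homotopy category. -/
noncomputable def classToHo (X : Ho.{u}) (q : (hoFunctor Γ).obj X) :
    toHo.obj (ofGroup Γ) ⟶ X :=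
  classToHoHom (G := X.as.obj) q

/-- The localization is generated under composition by strict morphisms and inverses of
equivalences. Naturality holds for strict morphisms by `toHoHom_map` and passes to inverses and
composites. -/
theorem classToHo_naturality {X Y : Ho.{u}} (t : X ⟶ Y) (q : (hoFunctor Γ).obj X) :
    classToHo Y ((hoFunctor Γ).map t q) = classToHo X q ≫ t := by
  let P : MorphismProperty Ho.{u} := fun X Y t => ∀ q : (hoFunctor Γ).obj X,
    classToHo Y ((hoFunctor Γ).map t q) = classToHo X q ≫ t
  have hP : P.IsStableUnderComposition :=
    { comp_mem := fun {X Y Z} s t (hs : ∀ q, _) (ht : ∀ q, _) q => by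
        rw [← Category.assoc, ← hs q, ← ht]
        congr 1
        rw [Functor.map_comp]
        rfl }
  have h := Localization.Construction.morphismProperty_eq_top' P (fun G H w q => by
    induction q using Quotient.inductionOn with | h x
    exact (congrArg classToHoHom (hoFunctor_map_map w x)).trans (x.toHoHom_map w))
    (fun X Y e he q => by
      rw [← cancel_mono e.hom, Category.assoc, e.inv_hom_id, Category.comp_id]
      refine (he ((hoFunctor Γ).map e.inv q)).symm.trans ?_
      congr 1
      exact ConcreteCategory.congr_hom ((hoFunctor Γ).mapIso e).inv_hom_id q)
  have : P t := by rw [h]; trivial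
  exact this q

/-- The Yoneda argument: naturality is applied to the class of `id Γ`. -/
theorem classToHoHom_ofHoHom (t : HoHom Γ G) : classToHoHom (ofHoHom t) = t := by
  have := classToHo_naturality t (Quotient.mk (setoid Γ (ofGroup Γ)) (id Γ))
  refine this.trans ?_
  change (id Γ).toHoHom ≫ t = t
  rw [toHoHom_id, Category.id_comp]

theorem exists_toHoHom_eq (t : HoHom Γ G) : ∃ x : Cocycle Γ G, x.toHoHom = t := by
  obtain ⟨x, hx⟩ := Quotient.exists_rep (ofHoHom t)
  exact ⟨x, by rw [← classToHoHom_ofHoHom t, ← hx]; rfl⟩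

theorem toHoHom_eq_toHoHom_iff {x y : Cocycle Γ G} :
    x.toHoHom = y.toHoHom ↔ ∃ a, IsIso x y a := by
  refine ⟨fun h => ?_, fun ⟨_, h⟩ => toHoHom_eq_of_isIso h⟩
  have := congrArg ofHoHom h
  rw [ofHoHom_toHoHom, ofHoHom_toHoHom] at this
  exact Quotient.exact this

end Cocycle

end CrossedMod

/-! ### Second cohomology by multiplicative cocycles -/

namespace H2RootsOfUnity

variable {Γ Γ' : Type} [Group Γ] [Group Γ'] {d : ℕ}

/-- The multiplicative 2-cocycle condition for trivial coefficients. -/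
def IsMulCocycle (z : Γ → Γ → rootsOfUnity d ℂ) : Prop :=
  ∀ g h k, z (g * h) k * z g h = z h k * z g (h * k)

/-- The cocycle associated with a multiplicative 2-cocycle. -/
noncomputable def cocycle (z : Γ → Γ → rootsOfUnity d ℂ) (hz : IsMulCocycle z) :
    groupCohomology.cocycles₂ (Rep.trivial ℤ Γ (Additive (rootsOfUnity d ℂ))) :=
  ⟨fun p => Additive.ofMul (z p.1 p.2), (groupCohomology.mem_cocycles₂_iff
    (A := Rep.trivial ℤ Γ (Additive (rootsOfUnity d ℂ))) _).2 fun g h k =>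
      congrArg Additive.ofMul (hz g h k)⟩

/-- The cohomology class of a multiplicative 2-cocycle. -/
noncomputable def mk (z : Γ → Γ → rootsOfUnity d ℂ) (hz : IsMulCocycle z) :
    H2RootsOfUnity Γ d :=
  groupCohomology.H2π _ (cocycle z hz)

theorem exists_mk_eq (c : H2RootsOfUnity Γ d) : ∃ z hz, mk z hz = c := by
  induction c using groupCohomology.H2_induction_on with
  | h x =>
    refine ⟨fun g h => (x (g, h)).toMul, fun g h k => ?_, rfl⟩
    exact congrArg Additive.toMul ((groupCohomology.mem_cocycles₂_iff _).1 x.2 g h k)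

theorem mk_eq_mk_iff {z z' : Γ → Γ → rootsOfUnity d ℂ} {hz : IsMulCocycle z}
    {hz' : IsMulCocycle z'} : mk z hz = mk z' hz' ↔
      ∃ μ : Γ → rootsOfUnity d ℂ, ∀ g h, z g h * μ (g * h) = z' g h * (μ g * μ h) := by
  unfold mk
  rw [groupCohomology.H2π_eq_iff]
  have key : ∀ a b c x y : rootsOfUnity d ℂ, a / b * c = x / y ↔ x * b = y * (c * a) :=
    fun a b c x y => by
      rw [div_mul_eq_mul_div, div_eq_div_iff_mul_eq_mul, eq_comm, mul_comm a c, mul_comm _ y]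
  constructor
  · rintro ⟨x, hx⟩
    let μ : Γ → rootsOfUnity d ℂ := fun g => Additive.toMul (x g)
    exact ⟨μ, fun g h => (key (μ h) _ (μ g) _ _).1 (congrArg Additive.toMul (congrFun hx (g, h)))⟩
  · rintro ⟨μ, hμ⟩
    refine ⟨fun g => Additive.ofMul (μ g), funext fun p => ?_⟩
    exact congrArg Additive.ofMul ((key (μ p.2) (μ (p.1 * p.2)) (μ p.1) _ _).2 (hμ p.1 p.2))

theorem pullback_mk (f : Γ' →* Γ) (z : Γ → Γ → rootsOfUnity d ℂ) (hz : IsMulCocycle z) :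
    pullback f (mk z hz) = mk (fun g h => z (f g) (f h))
      (fun g h k => by simpa using hz (f g) (f h) (f k)) :=
  groupCohomology.H2π_comp_map_apply (A := Rep.trivial ℤ Γ (Additive (rootsOfUnity d ℂ)))
    (B := Rep.trivial ℤ Γ' (Additive (rootsOfUnity d ℂ))) f (𝟙 _) (cocycle z hz)

end H2RootsOfUnity

/-! ### Classification of weak homomorphisms to `kummer d` -/

namespace CrossedMod

/-- The crossed module `[ℂˣ → ℂˣ × ℂˣ]`, `t ↦ (1, t ^ d)`. -/
def kummer (d : ℕ) : CrossedMod.{0} where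
  G₁ := ℂˣ × ℂˣ
  G₂ := ℂˣ
  φ := MonoidHom.prod 1 (powMonoidHom d)
  act := 1
  φ_act g α := by
    rw [mul_comm, ← mul_assoc, mul_inv_cancel, one_mul]
    rfl
  act_φ α β := by
    rw [mul_comm, ← mul_assoc, mul_inv_cancel, one_mul]
    rfl

namespace Kummer

variable {Γ Γ' : Type} [Group Γ] [Group Γ'] {d : ℕ}

/-- The first coordinate of a weak homomorphism to `kummer d`. -/
def char (x : Cocycle Γ (kummer d)) : Γ →* ℂˣ :=
  MonoidHom.mk' (fun g => (show ℂˣ × ℂˣ from x.obj g).1) fun g h => by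
    have := congrArg (Prod.fst : ℂˣ × ℂˣ → ℂˣ) (x.obj_mul g h)
    exact ((mul_one _).symm.trans this.symm)

/-- The second coordinate of a weak homomorphism to `kummer d`. -/
def snd (x : Cocycle Γ (kummer d)) (g : Γ) : ℂˣ := (show ℂˣ × ℂˣ from x.obj g).2

/-- The defect of a weak homomorphism to `kummer d`. -/
def defect (x : Cocycle Γ (kummer d)) (g h : Γ) : ℂˣ := x.arr g h

theorem snd_mul (x : Cocycle Γ (kummer d)) (g h : Γ) :
    snd x g * snd x h = snd x (g * h) * defect x g h ^ d :=
  congrArg (Prod.snd : ℂˣ × ℂˣ → ℂˣ) (x.obj_mul g h)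

theorem defect_assoc (x : Cocycle Γ (kummer d)) (g h k : Γ) :
    defect x (g * h) k * defect x g h = defect x g (h * k) * defect x h k :=
  x.assoc g h k

theorem isIso_iff (x y : Cocycle Γ (kummer d)) (a : Γ → ℂˣ) : Cocycle.IsIso x y a ↔
    char x = char y ∧ (∀ g, snd y g = snd x g * a g ^ d) ∧
      ∀ g h, a (g * h) * defect y g h = defect x g h * a g * a h := by
  refine ⟨fun h => ⟨?_, fun g => congrArg (Prod.snd : ℂˣ × ℂˣ → ℂˣ) (h.1 g), h.2⟩,
    fun h => ⟨fun g => ?_, h.2.2⟩⟩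
  · ext1 g
    have := congrArg (Prod.fst : ℂˣ × ℂˣ → ℂˣ) (h.1 g)
    exact ((mul_one _).symm.trans this.symm)
  · refine Prod.ext ?_ (h.2.1 g)
    exact (DFunLike.congr_fun h.1 g).symm.trans (mul_one (char x g)).symm

/-- A weak homomorphism to `kummer d` from a character and a cocycle. -/
def ofCocycle (l : Γ →* ℂˣ) (z : Γ → Γ → rootsOfUnity d ℂ) (hz : H2RootsOfUnity.IsMulCocycle z) :
    Cocycle Γ (kummer d) where
  obj g := ((l g, 1) : ℂˣ × ℂˣ)
  arr g h := ((z g h : ℂˣ))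
  obj_mul g h := by
    refine Prod.ext ?_ ?_
    · exact (map_mul l g h).symm.trans (mul_one _).symm
    · change (1 : ℂˣ) * 1 = 1 * (z g h : ℂˣ) ^ d
      rw [(mem_rootsOfUnity _ _).1 (z g h).2]
  assoc g h k := by
    have := congrArg (Subgroup.subtype _) (hz g h k)
    rw [map_mul, map_mul] at this
    exact this.trans (mul_comm _ _)

theorem exists_root [NeZero d] (t : ℂˣ) : ∃ r : ℂˣ, r ^ d = t := by
  obtain ⟨z, hz⟩ := IsAlgClosed.exists_pow_nat_eq (t : ℂ) (Nat.pos_of_ne_zero (NeZero.ne d))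
  have hz0 : z ≠ 0 := fun h => t.ne_zero (by rw [← hz, h, zero_pow (NeZero.ne d)])
  exact ⟨Units.mk0 z hz0, Units.ext hz⟩

variable [NeZero d]

variable (d) in
/-- A chosen `d`-th root. -/
noncomputable def root (t : ℂˣ) : ℂˣ := (exists_root (d := d) t).choose

theorem root_pow (t : ℂˣ) : root d t ^ d = t := (exists_root t).choose_spec

/-- The defect of a weak homomorphism after dividing by roots of the second coordinate. -/
noncomputable def rootDefect (x : Cocycle Γ (kummer d)) (g h : Γ) : rootsOfUnity d ℂ :=
  ⟨defect x g h * root d (snd x (g * h)) / (root d (snd x g) * root d (snd x h)), by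
    -- By `snd_mul`, the `d`-th power of the defect measures the failure of `snd x` to be
    -- multiplicative, which the `d`-th powers of the roots cancel.
    rw [mem_rootsOfUnity, div_pow, mul_pow, mul_pow, root_pow, root_pow, root_pow, snd_mul,
      mul_comm, div_self']⟩

theorem coe_rootDefect (x : Cocycle Γ (kummer d)) (g h : Γ) : (rootDefect x g h : ℂˣ) =
    defect x g h * root d (snd x (g * h)) / (root d (snd x g) * root d (snd x h)) := rfl

theorem isMulCocycle_rootDefect (x : Cocycle Γ (kummer d)) :
    H2RootsOfUnity.IsMulCocycle (rootDefect x) := fun g h k => by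
  apply Subtype.ext
  have e := congrArg Units.val (defect_assoc x g h k)
  simp only [Subgroup.coe_mul, coe_rootDefect, mul_assoc g h k]
  apply Units.ext
  push_cast at e ⊢
  field_simp
  linear_combination e

/-- The character and the cohomology class of a weak homomorphism to `kummer d`. -/
noncomputable def invariant (x : Cocycle Γ (kummer d)) : (Γ →* ℂˣ) × H2RootsOfUnity Γ d :=
  (char x, H2RootsOfUnity.mk (rootDefect x) (isMulCocycle_rootDefect x))

/-- Isomorphisms `a` and cochains `μ` determine each other by `a g * μ g = root d (snd y g) / root d
(snd x g)`. -/
theorem invariant_eq_iff {x y : Cocycle Γ (kummer d)} :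
    invariant x = invariant y ↔ ∃ a, Cocycle.IsIso x y a := by
  rw [invariant, invariant, Prod.mk_inj, H2RootsOfUnity.mk_eq_mk_iff]
  constructor
  · rintro ⟨hc, μ, hμ⟩
    refine ⟨fun g => root d (snd y g) / root d (snd x g) * (μ g : ℂˣ)⁻¹,
      (isIso_iff _ _ _).2 ⟨hc, fun g => ?_, fun g h => ?_⟩⟩
    · rw [mul_pow, div_pow, root_pow, root_pow, inv_pow, (mem_rootsOfUnity _ _).1 (μ g).2]
      simp
    · have e := congrArg Units.val (congrArg Subtype.val (hμ g h))
      simp only [Subgroup.coe_mul, coe_rootDefect] at e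
      apply Units.ext
      push_cast at e ⊢
      field_simp at e ⊢
      linear_combination -e
  · rintro ⟨(a : Γ → ℂˣ), ha⟩
    obtain ⟨hc, h₂, h₃⟩ := (isIso_iff _ _ _).1 ha
    refine ⟨hc, fun g => ⟨root d (snd y g) / (root d (snd x g) * a g), ?_⟩, fun g h => ?_⟩
    · rw [mem_rootsOfUnity, div_pow, mul_pow, root_pow, root_pow, h₂, div_self']
    · apply Subtype.ext
      have e := congrArg Units.val (h₃ g h)
      simp only [Subgroup.coe_mul, coe_rootDefect]
      apply Units.ext
      push_cast at e ⊢
      field_simp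
      linear_combination -e

theorem exists_invariant_eq (c : (Γ →* ℂˣ) × H2RootsOfUnity Γ d) :
    ∃ x : Cocycle Γ (kummer d), invariant x = c := by
  obtain ⟨l, c⟩ := c
  obtain ⟨z, hz, rfl⟩ := H2RootsOfUnity.exists_mk_eq c
  refine ⟨ofCocycle l z hz, Prod.ext rfl ?_⟩
  -- The chosen root of `1` need not be `1`, so `z` is recovered only up to the coboundary of a
  -- constant.
  refine H2RootsOfUnity.mk_eq_mk_iff.2 ⟨fun _ => ⟨(root d 1)⁻¹, ?_⟩, fun g h => ?_⟩
  · rw [mem_rootsOfUnity, inv_pow, root_pow, inv_one]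
  · apply Subtype.ext
    change (z g h : ℂˣ) * root d 1 / (root d 1 * root d 1) * (root d 1)⁻¹ =
      (z g h : ℂˣ) * ((root d 1)⁻¹ * (root d 1)⁻¹)
    apply Units.ext
    push_cast
    field_simp

/-- The chosen roots depend only on the element of `ℂˣ`, so even the cocycles `rootDefect` restrict
strictly. -/
theorem invariant_comap (f : Γ' →* Γ) (x : Cocycle Γ (kummer d)) : invariant (x.comap f) =
    ((invariant x).1.comp f, H2RootsOfUnity.pullback f (invariant x).2) := by
  refine Prod.ext rfl ?_
  refine Eq.trans ?_ (H2RootsOfUnity.pullback_mk f _ _).symm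
  have h : rootDefect (x.comap f) = fun g h => rootDefect x (f g) (f h) := by
    ext1 g
    ext1 h
    apply Subtype.ext
    rw [coe_rootDefect, coe_rootDefect, ← map_mul]
    rfl
  have mk_congr : ∀ {z z' : Γ' → Γ' → rootsOfUnity d ℂ} (hz hz'), z = z' →
      H2RootsOfUnity.mk z hz = H2RootsOfUnity.mk z' hz' := by
    rintro z _ _ _ rfl
    rfl
  exact mk_congr _ _ h

end Kummer

end CrossedMod

/-! ### Regular functions and equivariant automorphisms of the punctured plane -/

namespace WeightedProjective

open MvPolynomial

theorem eq_of_eval_eq_on_punctured {P Q : MvPolynomial (Fin 2) ℂ}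
    (h : ∀ x : Punctured 2, eval x.1 P = eval x.1 Q) : P = Q := by
  -- The factor `X 0` forces agreement at the origin.
  have : X 0 * P = X 0 * Q := MvPolynomial.funext fun x => by
    rw [map_mul, map_mul, eval_X]
    by_cases hx : x = 0
    · simp [hx]
    · rw [h ⟨x, hx⟩]
  exact mul_left_cancel₀ (X_ne_zero 0) this

/-- A polynomial without zeros on a line is constant there. -/
theorem eval_eq_eval_add {σ : Type*} (Q : MvPolynomial σ ℂ) (u v : σ → ℂ)
    (h : ∀ t : ℂ, eval (u + t • v) Q ≠ 0) : eval u Q = eval (u + v) Q := by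
  let q : Polynomial ℂ := aeval (fun i => Polynomial.C (u i) + Polynomial.X * Polynomial.C (v i)) Q
  have hq : ∀ t, q.eval t = eval (u + t • v) Q := fun t => by
    have : (Polynomial.evalRingHom t).comp (aeval fun i => Polynomial.C (u i) +
        Polynomial.X * Polynomial.C (v i) : MvPolynomial σ ℂ →ₐ[ℂ] Polynomial ℂ).toRingHom =
        eval (u + t • v) := by
      ext
      · simp
      · simp [mul_comm (v _) t]
    exact RingHom.congr_fun this Q
  have hd : q.degree = 0 := by
    by_contra hd
    obtain ⟨t, ht⟩ := IsAlgClosed.exists_root q hd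
    exact h t ((hq t).symm.trans ht)
  rw [Polynomial.eq_C_of_degree_eq_zero hd] at hq
  have h0 := hq 0
  have h1 := hq 1
  rw [Polynomial.eval_C] at h0 h1
  rw [zero_smul, add_zero] at h0
  rw [one_smul] at h1
  rw [← h0, h1]

/-- `Q` is constant on each line that misses the origin, and horizontal and vertical such lines join
every point to `(1, 0)`. -/
theorem eval_eq_of_ne_zero_on_punctured (Q : MvPolynomial (Fin 2) ℂ)
    (h : ∀ x : Punctured 2, eval x.1 Q ≠ 0) (x : Punctured 2) :
    eval x.1 Q = eval ![1, 0] Q := by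
  have key : ∀ u v : Fin 2 → ℂ, (∃ i, u i ≠ 0 ∧ v i = 0) → eval u Q = eval (u + v) Q := by
    rintro u v ⟨i, hu, hv⟩
    refine eval_eq_eval_add Q u v fun t => h ⟨u + t • v, fun e => hu ?_⟩
    have := congrFun e i
    simpa [hv] using this
  have key' : ∀ s t : ℂ, t ≠ 0 → eval ![s, t] Q = eval ![1, 0] Q := fun s t ht => by
    rw [key ![s, t] ![1 - s, 0] ⟨1, ht, rfl⟩]
    refine (key _ ![0, -t] ⟨0, by simp, rfl⟩).trans ?_
    congr 2
    ext i
    fin_cases i <;> simp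
  obtain ⟨x, hx⟩ := x
  have e : x = ![x 0, x 1] := by ext i; fin_cases i <;> rfl
  by_cases h1 : x 1 = 0
  · have h0 : x 0 ≠ 0 := fun h0 => hx (by rw [e, h0, h1]; ext i; fin_cases i <;> rfl)
    refine (key x ![0, 1] ⟨0, h0, rfl⟩).trans ?_
    rw [← key' (x 0) 1 one_ne_zero]
    congr 2
    ext i
    fin_cases i <;> simp [h1]
  · change eval x Q = _
    rw [e, key' _ _ h1]

/-- Functions that are regular on the punctured plane are polynomial. -/
theorem exists_polynomial_of_regularAt {g : Punctured 2 → ℂ} (hg : ∀ p, RegularAt g p) :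
    ∃ P : MvPolynomial (Fin 2) ℂ, ∀ x, g x = eval x.1 P := by
  have ne : ∀ {Q : MvPolynomial (Fin 2) ℂ} {p : Fin 2 → ℂ}, eval p Q ≠ 0 → Q ≠ 0 := by
    rintro _ p h rfl
    exact h (map_zero _)
  obtain ⟨P, Q, hQ, hPQ⟩ := hg ⟨![1, 0], fun h => by simpa using congrFun h 0⟩
  obtain ⟨a, b, c, hab, rfl, rfl⟩ :=
    UniqueFactorizationMonoid.exists_reduced_factors' P Q (ne hQ)
  have hcb := ne hQ
  have hc : c ≠ 0 := left_ne_zero_of_mul hcb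
  have key : ∀ p : Punctured 2, eval p.1 b ≠ 0 ∧ g p = eval p.1 a / eval p.1 b := fun p => by
    obtain ⟨P', Q', hQ', h'⟩ := hg p
    -- The extra factor `c * b * Q'` makes both sides vanish where a denominator does.
    have e : (c * a * Q') * (c * b * Q') = (P' * (c * b)) * (c * b * Q') := by
      refine eq_of_eval_eq_on_punctured fun x => ?_
      by_cases h1 : eval x.1 (c * b) = 0
      · rw [map_mul _ (c * a * Q'), map_mul _ (P' * (c * b)), map_mul _ (c * b) Q', h1]; simp
      by_cases h2 : eval x.1 Q' = 0
      · rw [map_mul _ (c * a * Q'), map_mul _ (P' * (c * b)), map_mul _ (c * b) Q', h2]; simp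
      have e := (hPQ x h1).symm.trans (h' x h2)
      rw [div_eq_div_iff h1 h2] at e
      rw [map_mul, map_mul _ (c * a), e, map_mul _ (P' * (c * b)), map_mul _ P']
    have e := mul_right_cancel₀ (mul_ne_zero hcb (ne hQ')) e
    have e : a * Q' = P' * b := mul_left_cancel₀ hc (by linear_combination e)
    -- The reduced denominator divides every local one, hence has no zero on the punctured plane.
    have hb : b ∣ Q' := hab.symm.dvd_of_dvd_mul_left ⟨P', by rw [e, mul_comm]⟩
    have hbp : eval p.1 b ≠ 0 := fun h0 => by
      obtain ⟨r, rfl⟩ := hb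
      exact hQ' (by rw [map_mul, h0, zero_mul])
    refine ⟨hbp, ?_⟩
    rw [h' p hQ', div_eq_div_iff hQ' hbp, ← map_mul, ← map_mul, ← e]
  refine ⟨C (eval ![1, 0] b)⁻¹ * a, fun x => ?_⟩
  rw [(key x).2, eval_eq_of_ne_zero_on_punctured b (fun x => (key x).1) x, map_mul, eval_C,
    div_eq_inv_mul]

theorem coeff_aeval_C_mul_X {σ R : Type*} [CommSemiring R] (s : σ → R) (P : MvPolynomial σ R)
    (e : σ →₀ ℕ) :
    coeff e (aeval (fun i => C (s i) * X i : σ → MvPolynomial σ R) P) =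
      (e.prod fun i k => s i ^ k) * coeff e P := by
  classical
  induction P using MvPolynomial.induction_on' with
  | monomial u a =>
    have : aeval (fun i => C (s i) * X i : σ → MvPolynomial σ R) (monomial u a) =
        monomial u ((u.prod fun i k => s i ^ k) * a) := by
      rw [aeval_monomial, monomial_eq, C_mul, algebraMap_eq, map_finsuppProd]
      simp only [mul_pow, Finsupp.prod_mul, C_pow]
      ring
    rw [this, coeff_monomial, coeff_monomial]
    split_ifs with h
    · rw [h]
    · simp
  | add p q hp hq => rw [map_add, coeff_add, coeff_add, hp, hq, mul_add]

theorem weight_of_coeff_ne_zero {w : Fin 2 → ℕ} {k : ℕ} {P : MvPolynomial (Fin 2) ℂ}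
    (h : ∀ (t : ℂˣ) (x : Punctured 2), eval (weightedAction w t x).1 P = t ^ k * eval x.1 P)
    {e : Fin 2 →₀ ℕ} (he : coeff e P ≠ 0) : ∑ i, e i * w i = k := by
  -- One scalar suffices, because the powers of `2` are distinct.
  let t : ℂˣ := Units.mk0 2 two_ne_zero
  have hP : aeval (fun i => C ((2 : ℂ) ^ w i) * X i : Fin 2 → MvPolynomial (Fin 2) ℂ) P =
      C (2 ^ k) * P := by
    refine eq_of_eval_eq_on_punctured fun x => ?_
    rw [map_mul, eval_C]
    refine Eq.trans ?_ (h t x)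
    have : (eval x.1).comp (aeval fun i => C ((2 : ℂ) ^ w i) * X i :
        MvPolynomial (Fin 2) ℂ →ₐ[ℂ] MvPolynomial (Fin 2) ℂ).toRingHom =
        eval (weightedAction w t x).1 := by
      ext i
      · simp
      · simp [weightedAction_apply, t]
    exact RingHom.congr_fun this P
  have hc := congrArg (coeff e) hP
  rw [coeff_aeval_C_mul_X, coeff_C_mul] at hc
  have := mul_right_cancel₀ he hc
  rw [Finsupp.prod_fintype _ _ (fun i => pow_zero _)] at this
  simp only [← pow_mul] at this
  rw [Finset.prod_pow_eq_pow_sum] at this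
  have h2 : (2 : ℕ) ^ (∑ i, w i * e i) = 2 ^ k := by exact_mod_cast this
  rw [← Nat.pow_right_injective le_rfl h2]
  exact Finset.sum_congr rfl fun i _ => mul_comm _ _

theorem exists_polynomial_of_mem_equivariantAut {w : Fin 2 → ℕ} (f : equivariantAut w)
    (i : Fin 2) : ∃ P : MvPolynomial (Fin 2) ℂ, (∀ x, (f.1 x).1 i = eval x.1 P) ∧
      ∀ e, coeff e P ≠ 0 → ∑ l, e l * w l = w i := by
  obtain ⟨P, hP⟩ := exists_polynomial_of_regularAt (f.2.1 i)
  refine ⟨P, hP, fun e he => weight_of_coeff_ne_zero (fun t x => ?_) he⟩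
  rw [← hP, ← hP, f.2.2.2]
  rfl

theorem univ_eq_pair {i j : Fin 2} (h : i ≠ j) : (Finset.univ : Finset (Fin 2)) = {i, j} := by
  revert i j
  decide

theorem eq_single_of_ne {i j : Fin 2} (h : i ≠ j) {e : Fin 2 →₀ ℕ} (he : e j = 0) :
    e = Finsupp.single i (e i) := by
  ext l
  have : l ∈ ({i, j} : Finset (Fin 2)) := univ_eq_pair h ▸ Finset.mem_univ l
  rw [Finset.mem_insert, Finset.mem_singleton] at this
  rcases this with rfl | rfl
  · simp
  · rw [he, Finsupp.single_eq_of_ne h.symm]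

/-- The only monomial of weight `w i` is `x_i`; those of weight `w j` are `x_j` and, if `w i ∣ w j`,
a power of `x_i`. -/
theorem exists_form {w : Fin 2 → ℕ} {i j : Fin 2} (hij : i ≠ j) (hi : 0 < w i) (hw : w i < w j)
    (f : equivariantAut w) : ∃ a b c : ℂ, (¬ w i ∣ w j → c = 0) ∧
      ∀ x, (f.1 x).1 i = a * x.1 i ∧ (f.1 x).1 j = b * x.1 j + c * x.1 i ^ (w j / w i) := by
  obtain ⟨P, hP, hP'⟩ := exists_polynomial_of_mem_equivariantAut f i
  obtain ⟨Q, hQ, hQ'⟩ := exists_polynomial_of_mem_equivariantAut f j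
  simp only [univ_eq_pair hij, Finset.sum_pair hij] at hP' hQ'
  have eP : P = monomial (Finsupp.single i 1) (coeff (Finsupp.single i 1) P) := by
    ext e
    rw [coeff_monomial]
    split_ifs with h
    · rw [h]
    · by_contra h0
      have := hP' e h0
      have hj : e j = 0 := by
        by_contra hj
        have := Nat.le_mul_of_pos_left (w j) (Nat.pos_of_ne_zero hj)
        omega
      rw [hj, zero_mul, add_zero] at this
      have : e i = 1 := Nat.eq_of_mul_eq_mul_right hi (by rw [this, one_mul])
      exact h (by rw [eq_single_of_ne hij hj, this])
  have hk : ∀ e, coeff e Q ≠ 0 → e = Finsupp.single j 1 ∨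
      w i ∣ w j ∧ e = Finsupp.single i (w j / w i) := fun e h0 => by
    have := hQ' e h0
    by_cases hj : e j = 0
    · right
      rw [hj, zero_mul, add_zero] at this
      refine ⟨⟨e i, by rw [← this, mul_comm]⟩, ?_⟩
      rw [← this, Nat.mul_div_cancel _ hi]
      exact eq_single_of_ne hij hj
    · left
      have h1 : e j = 1 := by
        by_contra h1
        have := Nat.mul_le_mul_right (w j) (show 2 ≤ e j by omega)
        omega
      rw [h1, one_mul] at this
      have h2 : e i = 0 := by
        by_contra h2
        have := Nat.le_mul_of_pos_left (w i) (Nat.pos_of_ne_zero h2)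
        omega
      rw [eq_single_of_ne hij.symm h2, h1]
  have hne : Finsupp.single j 1 ≠ Finsupp.single i (w j / w i) := fun h => by
    have := DFunLike.congr_fun h j
    rw [Finsupp.single_eq_same, Finsupp.single_eq_of_ne hij.symm] at this
    omega
  have eQ : Q = monomial (Finsupp.single j 1) (coeff (Finsupp.single j 1) Q) +
      monomial (Finsupp.single i (w j / w i)) (coeff (Finsupp.single i (w j / w i)) Q) := by
    ext e
    rw [coeff_add, coeff_monomial, coeff_monomial]
    by_cases h1 : Finsupp.single j 1 = e
    · subst h1
      rw [if_pos rfl, if_neg hne.symm, add_zero]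
    · rw [if_neg h1, zero_add]
      split_ifs with h2
      · rw [h2]
      · by_contra h0
        rcases hk e h0 with h | h
        · exact h1 h.symm
        · exact h2 h.2.symm
  refine ⟨coeff (Finsupp.single i 1) P, coeff (Finsupp.single j 1) Q,
    coeff (Finsupp.single i (w j / w i)) Q, fun hd => ?_, fun x => ⟨?_, ?_⟩⟩
  rotate_left
  · rw [hP]
    conv_lhs => rw [eP, eval_monomial]
    simp
  · rw [hQ]
    conv_lhs => rw [eQ, map_add, eval_monomial, eval_monomial]
    simp
  · by_contra h0
    rcases hk _ h0 with h | h
    · exact hne h.symm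
    · exact hd h.1

end WeightedProjective

/-! ### Diagonal maps, shears and matrix coefficients -/

namespace WeightedProjective

section coordinates

variable {w : Fin 2 → ℕ}

theorem ext_pair {i j : Fin 2} (hij : i ≠ j) {x y : Punctured 2} (hi : x.1 i = y.1 i)
    (hj : x.1 j = y.1 j) : x = y := by
  apply Subtype.ext
  ext l
  have : l ∈ ({i, j} : Finset (Fin 2)) := univ_eq_pair hij ▸ Finset.mem_univ l
  rw [Finset.mem_insert, Finset.mem_singleton] at this
  rcases this with rfl | rfl
  · exact hi
  · exact hj

theorem equivariantAut_ext {i j : Fin 2} (hij : i ≠ j) {f g : equivariantAut w}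
    (hi : ∀ x, (f.1 x).1 i = (g.1 x).1 i) (hj : ∀ x, (f.1 x).1 j = (g.1 x).1 j) : f = g :=
  Subtype.ext (Equiv.ext fun x => ext_pair hij (hi x) (hj x))

theorem isAlgebraic_of_polynomial {r : ℕ} {f : Punctured r → Punctured r}
    (h : ∀ i, ∃ P : MvPolynomial (Fin r) ℂ, ∀ x, (f x).1 i = MvPolynomial.eval x.1 P) :
    IsAlgebraic f := fun i p => by
  obtain ⟨P, hP⟩ := h i
  simp only [hP]
  exact regularAt_polynomial P p

/-- The diagonal maps as permutations of the punctured plane. -/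
def diagPerm : (Fin 2 → ℂˣ) →* Equiv.Perm (Punctured 2) :=
  MonoidHom.toHomPerm
    { toFun := fun s x => ⟨fun i => (s i : ℂ) * x.1 i, fun h => x.2 (by
        funext i
        simpa using congrFun h i)⟩
      map_one' := by
        funext x
        apply Subtype.ext
        funext i
        change ((1 : ℂˣ) : ℂ) * x.1 i = x.1 i
        simp
      map_mul' := fun s t => by
        funext x
        apply Subtype.ext
        funext i
        change ((s i * t i : ℂˣ) : ℂ) * x.1 i = (s i : ℂ) * ((t i : ℂ) * x.1 i)
        rw [Units.val_mul, mul_assoc] }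

theorem diagPerm_apply (s : Fin 2 → ℂˣ) (x : Punctured 2) (i : Fin 2) :
    (diagPerm s x).1 i = s i * x.1 i := rfl

theorem isAlgebraic_diagPerm (s : Fin 2 → ℂˣ) : IsAlgebraic (diagPerm s) :=
  isAlgebraic_of_polynomial fun i =>
    ⟨MvPolynomial.C (s i : ℂ) * MvPolynomial.X i, fun x => by simp [diagPerm_apply]⟩

variable (w) in
/-- The diagonal maps as equivariant automorphisms. -/
def diag : (Fin 2 → ℂˣ) →* equivariantAut w :=
  diagPerm.codRestrict (equivariantAut w) fun s =>
    ⟨isAlgebraic_diagPerm s, by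
      have h : (diagPerm s).symm = diagPerm s⁻¹ := by
        rw [map_inv]
        rfl
      rw [h]
      exact isAlgebraic_diagPerm _, fun t x => by
        apply Subtype.ext
        funext i
        rw [diagPerm_apply, weightedAction_apply, weightedAction_apply, diagPerm_apply]
        ring⟩

theorem diag_apply (s : Fin 2 → ℂˣ) (x : Punctured 2) (i : Fin 2) :
    ((diag w s).1 x).1 i = s i * x.1 i := rfl

/-- The shear `x_j ↦ x_j + c x_i ^ k` as a self-map of the punctured plane. -/
def shearMap {i j : Fin 2} (hij : i ≠ j) {k : ℕ} (hk : k ≠ 0) (c : ℂ) (x : Punctured 2) :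
    Punctured 2 :=
  ⟨fun l => x.1 l + Pi.single (M := fun _ => ℂ) j (c * x.1 i ^ k) l, fun h => by
    have h₁ : x.1 i = 0 := by simpa [hij] using congrFun h i
    have h₂ : x.1 j = 0 := by simpa [h₁, hk] using congrFun h j
    exact x.2 (funext fun l => by
      have : l ∈ ({i, j} : Finset (Fin 2)) := univ_eq_pair hij ▸ Finset.mem_univ l
      rw [Finset.mem_insert, Finset.mem_singleton] at this
      rcases this with rfl | rfl
      · exact h₁
      · exact h₂)⟩

section shear

variable {i j : Fin 2} (hij : i ≠ j) {k : ℕ} (hk : k ≠ 0)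

theorem shearMap_fst (c : ℂ) (x : Punctured 2) : (shearMap hij hk c x).1 i = x.1 i := by
  simp [shearMap, hij]

theorem shearMap_snd (c : ℂ) (x : Punctured 2) :
    (shearMap hij hk c x).1 j = x.1 j + c * x.1 i ^ k := by
  simp [shearMap]

theorem isAlgebraic_shearMap (c : ℂ) : IsAlgebraic (shearMap hij hk c) :=
  isAlgebraic_of_polynomial fun l => by
    refine ⟨MvPolynomial.X l + Pi.single (M := fun _ => MvPolynomial (Fin 2) ℂ) j
      (MvPolynomial.C c * MvPolynomial.X i ^ k) l, fun x => ?_⟩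
    by_cases h : l = j
    · subst h
      simp [shearMap]
    · simp [shearMap, h]

theorem shearMap_neg_shearMap (c : ℂ) (x : Punctured 2) :
    shearMap hij hk (-c) (shearMap hij hk c x) = x :=
  ext_pair hij (by rw [shearMap_fst, shearMap_fst])
    (by rw [shearMap_snd, shearMap_snd, shearMap_fst]; ring)

/-- The shear `x_j ↦ x_j + c x_i ^ k` as an equivariant automorphism. -/
def shear (hkw : w i * k = w j) (c : ℂ) : equivariantAut w :=
  ⟨⟨shearMap hij hk c, shearMap hij hk (-c), shearMap_neg_shearMap hij hk c, fun x => by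
      simpa using shearMap_neg_shearMap hij hk (-c) x⟩,
    isAlgebraic_shearMap hij hk c, isAlgebraic_shearMap hij hk (-c), fun t x => by
      change shearMap hij hk c _ = weightedAction w t (shearMap hij hk c x)
      apply ext_pair hij
      · rw [shearMap_fst, weightedAction_apply, weightedAction_apply, shearMap_fst]
      · rw [shearMap_snd, weightedAction_apply, weightedAction_apply, weightedAction_apply,
          shearMap_snd, ← hkw, pow_mul]
        ring⟩

theorem shear_fst (hkw : w i * k = w j) (c : ℂ) (x : Punctured 2) :
    ((shear hij hk hkw c).1 x).1 i = x.1 i := shearMap_fst hij hk c x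

theorem shear_snd (hkw : w i * k = w j) (c : ℂ) (x : Punctured 2) :
    ((shear hij hk hkw c).1 x).1 j = x.1 j + c * x.1 i ^ k := shearMap_snd hij hk c x

end shear

/-- The coordinate points of the punctured plane. -/
def basisPt (i : Fin 2) : Punctured 2 :=
  ⟨Pi.single i 1, fun h => by simpa using congrFun h i⟩

theorem basisPt_same (i : Fin 2) : (basisPt i).1 i = 1 := Pi.single_eq_same _ _

theorem basisPt_ne {i j : Fin 2} (h : j ≠ i) : (basisPt i).1 j = 0 := Pi.single_eq_of_ne h _

/-- The matrix coefficients of a map at the coordinate points. -/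
def entry (f : equivariantAut w) (i j : Fin 2) : ℂ := (f.1 (basisPt i)).1 j

end coordinates

section form

variable {w : Fin 2 → ℕ} {i j : Fin 2}

theorem div_ne_zero_of_lt (hi : 0 < w i) (hw : w i < w j)
    : w j / w i ≠ 0 := (Nat.div_pos hw.le hi).ne'

theorem entry_eq_zero (hij : i ≠ j) (hi : 0 < w i) (hw : w i < w j)
    (h : ¬ w i ∣ w j) (f : equivariantAut w) : entry f i j = 0 := by
  obtain ⟨a, b, c, hc, hf⟩ := exists_form hij hi hw f
  rw [entry, (hf _).2, hc h, basisPt_ne hij.symm]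
  simp

theorem apply_fst (hij : i ≠ j) (hi : 0 < w i) (hw : w i < w j)
    (f : equivariantAut w) (x : Punctured 2) :
    (f.1 x).1 i = entry f i i * x.1 i := by
  obtain ⟨a, b, c, -, hf⟩ := exists_form hij hi hw f
  rw [entry, (hf _).1, (hf _).1, basisPt_same, mul_one]

theorem apply_snd (hij : i ≠ j) (hi : 0 < w i) (hw : w i < w j)
    (f : equivariantAut w) (x : Punctured 2) :
    (f.1 x).1 j = entry f j j * x.1 j + entry f i j * x.1 i ^ (w j / w i) := by
  obtain ⟨a, b, c, -, hf⟩ := exists_form hij hi hw f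
  rw [entry, entry, (hf _).2, (hf _).2, (hf _).2, basisPt_same, basisPt_same, basisPt_ne hij,
    basisPt_ne hij.symm, zero_pow (div_ne_zero_of_lt hi hw)]
  simp

theorem entry_mul_fst (hij : i ≠ j) (hi : 0 < w i) (hw : w i < w j)
    (f g : equivariantAut w) :
    entry (f * g) i i = entry f i i * entry g i i :=
  apply_fst hij hi hw f (g.1 (basisPt i))

theorem entry_mul_snd (hij : i ≠ j) (hi : 0 < w i) (hw : w i < w j)
    (f g : equivariantAut w) :
    entry (f * g) j j = entry f j j * entry g j j := by
  refine (apply_snd hij hi hw f (g.1 (basisPt j))).trans ?_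
  rw [apply_fst hij hi hw g, basisPt_ne hij, mul_zero, zero_pow (div_ne_zero_of_lt hi hw),
    mul_zero, add_zero]
  rfl

theorem entry_mul_offdiag (hij : i ≠ j) (hi : 0 < w i) (hw : w i < w j)
    (f g : equivariantAut w) : entry (f * g) i j =
    entry f j j * entry g i j + entry f i j * entry g i i ^ (w j / w i) :=
  apply_snd hij hi hw f (g.1 (basisPt i))

/-- The diagonal coefficients, as a pair of characters. -/
def charPair (hij : i ≠ j) (hi : 0 < w i) (hw : w i < w j) :
    equivariantAut w →* ℂˣ × ℂˣ :=
  MonoidHom.prod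
    (MonoidHom.toHomUnits
      { toFun := fun f => entry f i i
        map_one' := basisPt_same i
        map_mul' := entry_mul_fst hij hi hw })
    (MonoidHom.toHomUnits
      { toFun := fun f => entry f j j
        map_one' := basisPt_same j
        map_mul' := entry_mul_snd hij hi hw })

theorem charPair_fst (hij : i ≠ j) (hi : 0 < w i) (hw : w i < w j)
    (f : equivariantAut w) :
    ((charPair hij hi hw f).1 : ℂ) = entry f i i := rfl

theorem charPair_snd (hij : i ≠ j) (hi : 0 < w i) (hw : w i < w j)
    (f : equivariantAut w) :
    ((charPair hij hi hw f).2 : ℂ) = entry f j j := rfl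

end form

end WeightedProjective

/-! ### Averaging, and integral matrices acting on pairs -/

/-- A crossed homomorphism from a finite group to a one-dimensional representation over a field
of characteristic zero is principal. -/
theorem exists_eq_mul_sub_of_crossed {Γ K : Type*} [Group Γ] [Finite Γ] [Field K] [CharZero K]
    (χ δ : Γ → K) (h : ∀ g k, δ (g * k) = δ k + δ g * χ k) :
    ∃ c, ∀ g, δ g = c * (χ g - 1) := by
  have := Fintype.ofFinite Γ
  have hN : (Fintype.card Γ : K) ≠ 0 := Nat.cast_ne_zero.2 Fintype.card_ne_zero
  -- The constant is minus the mean of `δ`: summing the crossed relation over `g` leaves the sum of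
  -- `δ` on the left, by translation invariance.
  refine ⟨-(∑ g, δ g) / Fintype.card Γ, fun k => ?_⟩
  have e : ∑ g, δ g = ∑ g, δ (g * k) := (Equiv.sum_comp (Equiv.mulRight k) δ).symm
  simp only [h, Finset.sum_add_distrib, Finset.sum_const, ← Finset.sum_mul, Finset.card_univ,
    nsmul_eq_mul] at e
  field_simp
  linear_combination -e

theorem zpow_mul_zpow_combine {A : Type*} [CommGroup A] (x y : A) (a b c e r s : ℤ) :
    (x ^ a * y ^ b) ^ r * (x ^ c * y ^ e) ^ s = x ^ (a * r + c * s) * y ^ (b * r + e * s) := by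
  rw [mul_zpow, mul_zpow, ← zpow_mul, ← zpow_mul, ← zpow_mul, ← zpow_mul, zpow_add, zpow_add,
    mul_mul_mul_comm]

/-- The endomorphism of `A × A` given by an integral matrix. -/
def zpowMatrixHom (A : Type*) [CommGroup A] (a b c e : ℤ) : A × A →* A × A :=
  MonoidHom.prod
    ((zpowGroupHom a).comp (MonoidHom.fst A A) * (zpowGroupHom b).comp (MonoidHom.snd A A))
    ((zpowGroupHom c).comp (MonoidHom.fst A A) * (zpowGroupHom e).comp (MonoidHom.snd A A))

theorem zpowMatrixHom_apply {A : Type*} [CommGroup A] (a b c e : ℤ) (x : A × A) :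
    zpowMatrixHom A a b c e x = (x.1 ^ a * x.2 ^ b, x.1 ^ c * x.2 ^ e) := rfl

theorem zpowMatrixHom_zpowMatrixHom {A : Type*} [CommGroup A] {a b c e a' b' c' e' : ℤ}
    (h₁ : a * a' + c * b' = 1) (h₂ : b * a' + e * b' = 0) (h₃ : a * c' + c * e' = 0)
    (h₄ : b * c' + e * e' = 1) (x : A × A) :
    zpowMatrixHom A a' b' c' e' (zpowMatrixHom A a b c e x) = x := by
  rw [zpowMatrixHom_apply, zpowMatrixHom_apply]
  simp only [zpow_mul_zpow_combine, h₁, h₂, h₃, h₄, zpow_one, zpow_zero, mul_one, one_mul]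

/-- The row `(-q, p)` kills the exponent vector `(p, q)` and the Bézout row `(u, v)` sends it to
`1`; the determinant is `-1`, so the matrix is invertible. -/
theorem zpowMatrixHom_pow {A : Type*} [CommGroup A] {d p q : ℕ} {u v : ℤ}
    (huv : u * p + v * q = 1) (t : A) :
    zpowMatrixHom A (-q) p u v (t ^ (d * p), t ^ (d * q)) = (1, t ^ d) := by
  rw [zpowMatrixHom_apply]
  simp only [← zpow_natCast, ← zpow_mul, ← zpow_add]
  refine Prod.ext ?_ ?_
  · refine (congrArg (t ^ ·) ?_).trans (zpow_zero t)
    push_cast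
    ring
  · refine congrArg (t ^ ·) ?_
    push_cast
    linear_combination d * huv

theorem zpowMatrixHom_one_pow {A : Type*} [CommGroup A] (d p q : ℕ) (u v : ℤ) (t : A) :
    zpowMatrixHom A v p u q (1, t ^ d) = (t ^ (d * p), t ^ (d * q)) := by
  rw [zpowMatrixHom_apply]
  simp only [one_zpow, one_mul, zpow_natCast, ← pow_mul]

/-! ### Comparison of `PGL w` with `kummer d` -/

namespace WeightedProjective

open CrossedMod

variable {w : Fin 2 → ℕ} {i j : Fin 2}

/-- A pair of units as a diagonal matrix with prescribed `i`-th entry. -/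
def pairHom (i : Fin 2) : ℂˣ × ℂˣ →* (Fin 2 → ℂˣ) :=
  MonoidHom.mk' (fun s l => if l = i then s.1 else s.2) fun s t => by
    funext l
    by_cases h : l = i <;> simp [h]

theorem pairHom_same (s : ℂˣ × ℂˣ) : pairHom i s i = s.1 := if_pos rfl

theorem pairHom_ne (h : j ≠ i) (s : ℂˣ × ℂˣ) : pairHom i s j = s.2 := if_neg h

theorem charPair_diag (hij : i ≠ j) (hi : 0 < w i) (hw : w i < w j) (s : ℂˣ × ℂˣ) :
    charPair hij hi hw (diag w (pairHom i s)) = s := by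
  ext
  · rw [charPair_fst, entry, diag_apply, pairHom_same, basisPt_same, mul_one]
  · rw [charPair_snd, entry, diag_apply, pairHom_ne hij.symm, basisPt_same, mul_one]

/-- The weighted action as an element of the automorphism group is diagonal. -/
theorem PGL_φ_eq_diag (hij : i ≠ j) (t : ℂˣ) :
    (PGL w).φ t = diag w (pairHom i (t ^ w i, t ^ w j)) := by
  refine equivariantAut_ext hij (fun x => ?_) (fun x => ?_)
  · rw [diag_apply, pairHom_same]
    exact (weightedAction_apply w t x i).trans (by rw [Units.val_pow_eq_pow_val])
  · rw [diag_apply, pairHom_ne hij.symm]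
    exact (weightedAction_apply w t x j).trans (by rw [Units.val_pow_eq_pow_val])

section

variable {d p q : ℕ} {u v : ℤ}

/-- The strict morphism from `PGL w` to `kummer d` given by the diagonal coefficients. -/
def toKummer (hij : i ≠ j) (hi : 0 < w i) (hw : w i < w j) (hp : w i = d * p) (hq : w j = d * q)
    (huv : u * p + v * q = 1) : PGL w ⟶ kummer d :=
  Hom.mk (G := PGL w) (H := kummer d)
    ((zpowMatrixHom ℂˣ (-q) p u v).comp (charPair hij hi hw)) (MonoidHom.id ℂˣ)
    (fun t => by
      refine (congrArg (fun f => zpowMatrixHom ℂˣ (-q) p u v (charPair hij hi hw f))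
        (PGL_φ_eq_diag hij t)).trans ?_
      refine (congrArg (zpowMatrixHom ℂˣ (-q) p u v) (charPair_diag hij hi hw _)).trans ?_
      rw [hp, hq]
      exact zpowMatrixHom_pow (A := ℂˣ) huv t)
    (fun _ _ => rfl)

/-- The strict section of `toKummer` with diagonal values. -/
def ofKummer (hij : i ≠ j) (hp : w i = d * p) (hq : w j = d * q) (u v : ℤ) :
    kummer d ⟶ PGL w :=
  Hom.mk (G := kummer d) (H := PGL w)
    ((diag w).comp ((pairHom i).comp (zpowMatrixHom ℂˣ (-v) p u q))) (MonoidHom.id ℂˣ)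
    (fun t => by
      refine Eq.trans ?_ (PGL_φ_eq_diag hij t).symm
      refine congrArg (fun s => diag w (pairHom i s)) ?_
      rw [hp, hq]
      exact zpowMatrixHom_one_pow (A := ℂˣ) d p q u (-v) t)
    (fun _ _ => rfl)

theorem ofKummer_comp_toKummer (hij : i ≠ j) (hi : 0 < w i) (hw : w i < w j) (hp : w i = d * p)
    (hq : w j = d * q) (huv : u * p + v * q = 1) :
    ofKummer hij hp hq u v ≫ toKummer hij hi hw hp hq huv = 𝟙 _ := by
  apply Hom.ext
  · ext s : 1
    refine (congrArg (zpowMatrixHom ℂˣ (-q) p u v) (charPair_diag hij hi hw _)).trans ?_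
    refine zpowMatrixHom_zpowMatrixHom ?_ ?_ ?_ ?_ _
    · linear_combination huv
    · ring
    · ring
    · linear_combination huv
  · rfl

theorem ofKummer_toKummer_hom₁ (hij : i ≠ j) (hi : 0 < w i) (hw : w i < w j) (hp : w i = d * p)
    (hq : w j = d * q) (huv : u * p + v * q = 1) (f : equivariantAut w) :
    Hom.hom₁ (ofKummer hij hp hq u v) (Hom.hom₁ (toKummer hij hi hw hp hq huv) f) =
      diag w (pairHom i (charPair hij hi hw f)) := by
  refine congrArg (fun s => diag w (pairHom i s)) ?_
  refine zpowMatrixHom_zpowMatrixHom ?_ ?_ ?_ ?_ _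
  · linear_combination huv
  · ring
  · ring
  · linear_combination huv

/-- The target has commutative `G₁`, and `PGL w` acts trivially on `ℂˣ`. -/
theorem conj_comp_toKummer (hij : i ≠ j) (hi : 0 < w i) (hw : w i < w j) (hp : w i = d * p)
    (hq : w j = d * q) (huv : u * p + v * q = 1) (a : equivariantAut w) :
    (PGL w).conj a ≫ toKummer hij hi hw hp hq huv = toKummer hij hi hw hp hq huv := by
  apply Hom.ext
  · ext f : 1
    let χ := (zpowMatrixHom ℂˣ (-q) p u v).comp (charPair hij hi hw)
    let f' : equivariantAut w := f
    change χ (a⁻¹ * f' * a⁻¹⁻¹) = χ f'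
    rw [map_mul, map_mul, inv_inv, map_inv, mul_comm, mul_inv_cancel_left]
  · rfl

end

/-- The values of a weak homomorphism to `PGL w`, as automorphisms. -/
def autObj {Γ : Type} [Group Γ] (x : Cocycle Γ (PGL w)) (g : Γ) : equivariantAut w := x.obj g

/-- A weak homomorphism to `PGL w` is conjugate to a diagonal one. -/
theorem exists_conj_eq_diag {Γ : Type} [Group Γ] (hij : i ≠ j) (hi : 0 < w i) (hw : w i < w j)
    (hΓ : Finite Γ ∨ ¬ w i ∣ w j) (x : Cocycle Γ (PGL w)) :
    ∃ a : equivariantAut w, ∀ g, a⁻¹ * autObj x g * a =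
      diag w (pairHom i (charPair hij hi hw (autObj x g))) := by
  by_cases hd : w i ∣ w j
  · have hfin : Finite Γ := hΓ.resolve_right (not_not.2 hd)
    have hk := div_ne_zero_of_lt hi hw
    have hkw : w i * (w j / w i) = w j := Nat.mul_div_cancel' hd
    let f : Γ → equivariantAut w := autObj x
    have hf : ∀ g h, ∃ t : ℂˣ, f g * f h =
        f (g * h) * diag w (pairHom i (t ^ w i, t ^ w j)) := fun g h =>
      ⟨x.arr g h, (x.obj_mul g h).trans (congrArg (f (g * h) * ·) (PGL_φ_eq_diag hij _))⟩
    have h0 : ∀ g, entry (f g) j j ≠ 0 := fun g => (charPair hij hi hw (f g)).2.ne_zero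
    -- The defect `t` multiplies numerators and denominators alike by `t ^ w j`, so it drops out of
    -- both quotients: the first is multiplicative and the second is crossed for it.
    obtain ⟨u, hu⟩ := exists_eq_mul_sub_of_crossed
      (fun g => entry (f g) i i ^ (w j / w i) / entry (f g) j j)
      (fun g => entry (f g) i j / entry (f g) j j) (fun g h => by
        obtain ⟨t, ht⟩ := hf g h
        have e₁ := congrArg (fun a => entry a j j) ht
        have e₂ := congrArg (fun a => entry a i j) ht
        have d₁ : entry (diag w (pairHom i (t ^ w i, t ^ w j))) i i = (t : ℂ) ^ w i := by
          rw [entry, diag_apply, pairHom_same, basisPt_same, mul_one, Units.val_pow_eq_pow_val]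
        have d₂ : entry (diag w (pairHom i (t ^ w i, t ^ w j))) j j = (t : ℂ) ^ w j := by
          rw [entry, diag_apply, pairHom_ne hij.symm, basisPt_same, mul_one,
            Units.val_pow_eq_pow_val]
        have d₃ : entry (diag w (pairHom i (t ^ w i, t ^ w j))) i j = 0 := by
          rw [entry, diag_apply, basisPt_ne hij.symm, mul_zero]
        simp only [entry_mul_snd hij hi hw, entry_mul_offdiag hij hi hw, d₁, d₂, d₃, ← pow_mul,
          hkw] at e₁ e₂
        have b := h0 g
        have b' := h0 h
        have b'' := h0 (g * h)
        have ht0 : (t : ℂ) ^ w j ≠ 0 := pow_ne_zero _ t.ne_zero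
        have e : entry (f (g * h)) i j / entry (f (g * h)) j j =
            (entry (f g) j j * entry (f h) i j + entry (f g) i j *
              entry (f h) i i ^ (w j / w i)) / (entry (f g) j j * entry (f h) j j) := by
          rw [e₁, e₂]
          field_simp
          ring
        rw [e]
        field_simp)
    -- The shear by `u` diagonalises `f g` exactly when `entry (f g) i j = u * (entry (f g) i i ^ k
    -- - entry (f g) j j)` with `k = w j / w i`, which is `hu` without denominators.
    refine ⟨shear hij hk hkw u, fun g => ?_⟩
    change _⁻¹ * f g * _ = diag w (pairHom i (charPair hij hi hw (f g)))
    rw [mul_assoc, inv_mul_eq_iff_eq_mul]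
    refine equivariantAut_ext hij (fun y => ?_) (fun y => ?_)
    · refine (apply_fst hij hi hw (f g) ((shear hij hk hkw u).1 y)).trans ?_
      refine Eq.trans ?_ (shear_fst hij hk hkw u _).symm
      rw [shear_fst, diag_apply, pairHom_same, charPair_fst]
    · refine (apply_snd hij hi hw (f g) ((shear hij hk hkw u).1 y)).trans ?_
      refine Eq.trans ?_ (shear_snd hij hk hkw u _).symm
      rw [shear_fst, shear_snd, diag_apply, diag_apply, pairHom_same, pairHom_ne hij.symm,
        charPair_fst, charPair_snd]
      have e := hu g
      have b := h0 g
      field_simp at e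
      rw [e]
      ring
  · refine ⟨1, fun g => ?_⟩
    rw [inv_one, one_mul, mul_one]
    refine equivariantAut_ext hij (fun y => ?_) (fun y => ?_)
    · rw [apply_fst hij hi hw, diag_apply, pairHom_same, charPair_fst]
    · rw [apply_snd hij hi hw, diag_apply, pairHom_ne hij.symm, charPair_snd,
        entry_eq_zero hij hi hw hd, zero_mul, add_zero]

variable {d p q : ℕ} {u v : ℤ}

theorem exists_map_conj_eq {Γ : Type} [Group Γ] (hij : i ≠ j) (hi : 0 < w i) (hw : w i < w j)
    (hp : w i = d * p) (hq : w j = d * q) (huv : u * p + v * q = 1)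
    (hΓ : Finite Γ ∨ ¬ w i ∣ w j) (x : Cocycle Γ (PGL w)) :
    ∃ a, x.map ((PGL w).conj a) =
      (x.map (toKummer hij hi hw hp hq huv)).map (ofKummer hij hp hq u v) := by
  obtain ⟨a, ha⟩ := exists_conj_eq_diag hij hi hw hΓ x
  refine ⟨a, Cocycle.ext (funext fun g => ?_) rfl⟩
  change a⁻¹ * autObj x g * a⁻¹⁻¹ = _
  rw [inv_inv, ha]
  exact (ofKummer_toKummer_hom₁ hij hi hw hp hq huv _).symm

/-! ### The invariants of a conjugacy class, and their naturality -/

variable [NeZero d]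

/-- The invariants of a homotopy class of maps to `PGL w`. -/
noncomputable def hoInvariant (hij : i ≠ j) (hi : 0 < w i) (hw : w i < w j) (hp : w i = d * p)
    (hq : w j = d * q) (huv : u * p + v * q = 1) {Γ : Type} [Group Γ]
    (t : HoHom Γ (PGL w)) : (Γ →* ℂˣ) × H2RootsOfUnity Γ d :=
  Kummer.invariant ((Cocycle.exists_toHoHom_eq t).choose.map (toKummer hij hi hw hp hq huv))

section

variable (hij : i ≠ j) (hi : 0 < w i) (hw : w i < w j) (hp : w i = d * p)
  (hq : w j = d * q) (huv : u * p + v * q = 1) {Γ Γ' : Type} [Group Γ] [Group Γ']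

/-- The representative chosen in `hoInvariant` is isomorphic to `x`, and isomorphic weak
homomorphisms have equal invariants. -/
theorem hoInvariant_toHoHom (x : Cocycle Γ (PGL w)) :
    hoInvariant hij hi hw hp hq huv x.toHoHom =
      Kummer.invariant (x.map (toKummer hij hi hw hp hq huv)) := by
  obtain ⟨a, ha⟩ := Cocycle.toHoHom_eq_toHoHom_iff.1
    (Cocycle.exists_toHoHom_eq x.toHoHom).choose_spec
  exact Kummer.invariant_eq_iff.2 ⟨_, ha.map _⟩

theorem hoInvariant_comp_conj (t : HoHom Γ (PGL w)) (a : (PGL w).G₁) :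
    hoInvariant hij hi hw hp hq huv (t ≫ toHo.map ((PGL w).conj a)) =
      hoInvariant hij hi hw hp hq huv t := by
  obtain ⟨x, rfl⟩ := Cocycle.exists_toHoHom_eq t
  rw [← Cocycle.toHoHom_map, hoInvariant_toHoHom, hoInvariant_toHoHom]
  exact congrArg (fun k => Kummer.invariant (x.map k))
    (conj_comp_toKummer hij hi hw hp hq huv a)

theorem hoInvariant_pullback (f : Γ' →* Γ) (t : HoHom Γ (PGL w)) :
    hoInvariant hij hi hw hp hq huv (toHo.map (ofGroupHom f) ≫ t : HoHom Γ' (PGL w)) =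
      ((hoInvariant hij hi hw hp hq huv t).1.comp f,
        H2RootsOfUnity.pullback f (hoInvariant hij hi hw hp hq huv t).2) := by
  obtain ⟨x, rfl⟩ := Cocycle.exists_toHoHom_eq t
  rw [← Cocycle.toHoHom_comap, hoInvariant_toHoHom, hoInvariant_toHoHom]
  exact Kummer.invariant_comap f (x.map (toKummer hij hi hw hp hq huv))

/-- The invariants of a conjugacy class of homotopy classes of maps to `PGL w`. -/
noncomputable def classInvariant (c : HoConjClasses Γ (PGL w)) :
    (Γ →* ℂˣ) × H2RootsOfUnity Γ d :=
  Quotient.lift (hoInvariant hij hi hw hp hq huv) (by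
    rintro t _ ⟨a, rfl⟩
    exact (hoInvariant_comp_conj hij hi hw hp hq huv t a).symm) c

theorem classInvariant_pullback (f : Γ' →* Γ) (c : HoConjClasses Γ (PGL w)) :
    classInvariant hij hi hw hp hq huv (c.pullback f) =
      ((classInvariant hij hi hw hp hq huv c).1.comp f,
        H2RootsOfUnity.pullback f (classInvariant hij hi hw hp hq huv c).2) := by
  induction c using Quotient.inductionOn with | h t
  exact hoInvariant_pullback hij hi hw hp hq huv f t

/-- Up to conjugacy a weak homomorphism is `ofKummer` applied to its image under `toKummer`, which
gives injectivity; surjectivity holds because `toKummer` retracts `ofKummer`. -/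
theorem classInvariant_bijective (hΓ : Finite Γ ∨ ¬ w i ∣ w j) :
    Function.Bijective (classInvariant hij hi hw hp hq huv (Γ := Γ)) := by
  constructor
  · intro c c'
    induction c using Quotient.inductionOn with | h t
    induction c' using Quotient.inductionOn with | h t'
    intro h
    obtain ⟨x, rfl⟩ := Cocycle.exists_toHoHom_eq t
    obtain ⟨y, rfl⟩ := Cocycle.exists_toHoHom_eq t'
    have h' : hoInvariant hij hi hw hp hq huv x.toHoHom =
      hoInvariant hij hi hw hp hq huv y.toHoHom := h
    rw [hoInvariant_toHoHom, hoInvariant_toHoHom, Kummer.invariant_eq_iff] at h'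
    obtain ⟨b, hb⟩ := h'
    have e := Cocycle.toHoHom_eq_of_isIso (hb.map (ofKummer hij hp hq u v))
    have key : ∀ z : Cocycle Γ (PGL w), (Quotient.mk (conjSetoid Γ (PGL w)) z.toHoHom) =
        Quotient.mk _ ((z.map (toKummer hij hi hw hp hq huv)).map
          (ofKummer hij hp hq u v)).toHoHom := fun z => by
      obtain ⟨a, ha⟩ := exists_map_conj_eq hij hi hw hp hq huv hΓ z
      refine Quotient.sound ⟨a, ?_⟩
      rw [← ha, Cocycle.toHoHom_map]
    exact (key x).trans ((congrArg _ e).trans (key y).symm)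
  · intro c
    obtain ⟨x, rfl⟩ := Kummer.exists_invariant_eq c
    refine ⟨Quotient.mk _ (x.map (ofKummer hij hp hq u v)).toHoHom, ?_⟩
    refine (hoInvariant_toHoHom hij hi hw hp hq huv _).trans (congrArg _ ?_)
    change x.map (ofKummer hij hp hq u v ≫ toKummer hij hi hw hp hq huv) = _
    rw [ofKummer_comp_toKummer]
    rfl

end

/-- The predicate `P` allows a hypothesis on `Γ` that is symmetric in the weights, although `i` must
be the index of the smaller one. -/
theorem exists_natural_equiv {P : ∀ (Γ : Type) [Group Γ], Prop} (hij : i ≠ j) (hi : 0 < w i)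
    (hw : w i < w j) (hd : d = Nat.gcd (w i) (w j))
    (hP : ∀ (Γ : Type) [Group Γ], P Γ → Finite Γ ∨ ¬ w i ∣ w j) :
    ∃ Φ : ∀ (Γ : Type) [Group Γ], P Γ →
        (HoConjClasses Γ (PGL w) ≃ (Γ →* ℂˣ) × H2RootsOfUnity Γ d),
      ∀ (Γ Γ' : Type) [Group Γ] [Group Γ'] (h : P Γ) (h' : P Γ') (f : Γ' →* Γ)
        (x : HoConjClasses Γ (PGL w)),
        Φ Γ' h' (x.pullback f) = ((Φ Γ h x).1.comp f, H2RootsOfUnity.pullback f (Φ Γ h x).2) := by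
  obtain ⟨p, hp⟩ : d ∣ w i := hd ▸ Nat.gcd_dvd_left _ _
  obtain ⟨q, hq⟩ : d ∣ w j := hd ▸ Nat.gcd_dvd_right _ _
  obtain ⟨u, v, huv⟩ : ∃ u v : ℤ, u * p + v * q = 1 := by
    refine ⟨Nat.gcdA (w i) (w j), Nat.gcdB (w i) (w j), ?_⟩
    have h := Nat.gcd_eq_gcd_ab (w i) (w j)
    have hd0 : (d : ℤ) ≠ 0 := Nat.cast_ne_zero.2 (NeZero.ne d)
    apply mul_left_cancel₀ hd0
    rw [← hd] at h
    conv_rhs => rw [mul_one, h]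
    generalize Nat.gcdA (w i) (w j) = u
    generalize Nat.gcdB (w i) (w j) = v
    rw [hp, hq]
    push_cast
    ring
  exact ⟨fun Γ _ h => Equiv.ofBijective _ (classInvariant_bijective hij hi hw hp hq huv (hP Γ h)),
    fun Γ Γ' _ _ _ _ f x => classInvariant_pullback hij hi hw hp hq huv f x⟩

end WeightedProjective

theorem propositionP (m n : ℕ) (hm : 0 < m) (hn : 0 < n) (hmn : m ≠ n) :
    ∃ Φ : ∀ (Γ : Type) [Group Γ], (Finite Γ ∨ (¬ m ∣ n ∧ ¬ n ∣ m)) →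
        (CrossedMod.HoConjClasses Γ (WeightedProjective.PGL ![m, n]) ≃
          (Γ →* ℂˣ) × H2RootsOfUnity Γ (Nat.gcd m n)),
      ∀ (Γ Γ' : Type) [Group Γ] [Group Γ'] (h : Finite Γ ∨ (¬ m ∣ n ∧ ¬ n ∣ m))
        (h' : Finite Γ' ∨ (¬ m ∣ n ∧ ¬ n ∣ m)) (f : Γ' →* Γ)
        (x : CrossedMod.HoConjClasses Γ (WeightedProjective.PGL ![m, n])),
        Φ Γ' h' (x.pullback f) =
          ((Φ Γ h x).1.comp f, H2RootsOfUnity.pullback f (Φ Γ h x).2) := by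
  have : NeZero (Nat.gcd m n) := ⟨(Nat.gcd_pos_of_pos_left n hm).ne'⟩
  rcases lt_or_gt_of_ne hmn with h | h
  · exact WeightedProjective.exists_natural_equiv (w := ![m, n]) (i := 0) (j := 1)
      (P := fun Γ _ => Finite Γ ∨ (¬ m ∣ n ∧ ¬ n ∣ m)) zero_ne_one hm h rfl
      fun Γ _ hΓ => hΓ.imp_right And.left
  · exact WeightedProjective.exists_natural_equiv (w := ![m, n]) (i := 1) (j := 0)
      (P := fun Γ _ => Finite Γ ∨ (¬ m ∣ n ∧ ¬ n ∣ m)) one_ne_zero hn h (Nat.gcd_comm m n)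
      fun Γ _ hΓ => hΓ.imp_right And.right
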